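/- Let $\Xi=(\rho,\delta,\gamma)$. Consider the unicycle in polar coordinates on the state space $\{\rho>0\}\times\mathbb R^2$, $$\dot\Xi=\bar g_1(\Xi)\,\frac{v}{\rho}+g_2(\Xi)\,\omega,\qquad \bar g_1=\begin{bmatrix}-\rho\cos\gamma\\ \sin\gamma\\ \sin\gamma\end{bmatrix},\quad g_2=\begin{bmatrix}0\\0\\-1\end{bmatrix},$$ and let $$V(\rho,\delta,\gamma)=\rho^2+\delta^2+\bigl(\gamma+\tfrac12\arctan(2\delta)\bigr)^2,\qquad \nu_1=L_{\bar g_1}V,\quad \nu_2=L_{g_2}V .$$ For $a\in(0,\infty]$, a function on $[0,a)$ is of class $\mathcal K_\infty[0,a)$ if it is continuous, strictly increasing, zero at $0$, and tends to $\infty$ as $r\to a$. Let $a_1,a_2\in(0,\infty]$, and for $i=1,2$ let $\eta_i\in\mathcal K_\infty[0,a_i)$ be differentiable with $\eta_i'\in\mathcal K_\infty[0,a_i)$. Denote by $(\eta_i')^{-1}:[0,\infty)\to[0,a_i)$ the inverse function of $\eta_i'$ and by $\ell\eta_i(r)=\int_0^r(\eta_i')^{-1}(s)\,ds$ the Legendre–Fenchel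 transform; put $\eta_i(r)=+\infty$ for $r\ge a_i$. Let $\varepsilon_1,\varepsilon_2$ be continuous positive functions of $(\rho,\delta,\gamma)\in\{\rho\ge0\}\times\mathbb R^2$. (a) The state penalty $l(\Xi)=\ell\eta_1(\varepsilon_1|\nu_1|)+\ell\eta_2(\varepsilon_2|\nu_2|)$ is nonnegative on $\{\rho\ge0\}\times\mathbb R^2$ and vanishes there only at the origin. (b) For all initial conditions in $\{\rho>0\}\times\mathbb R^2$, the cost functional $$J=\int_0^\infty\Bigl[l(\rho,\delta,\gamma)+\eta_1\Bigl(\frac{|v|}{\varepsilon_1\rho}\Bigr)+\eta_2\Bigl(\frac{|\omega|}{\varepsilon_2}\Bigr)\Bigr]dt\in[0,\infty]$$ is minimized, over all controls $(v,\omega)$ that have a trajectory in $\{\rho>0\}\times\mathbb R^2$ on $[0,\infty)$ from the given initial condition, by the feedback law $$v^*=-\rho\,\varepsilon_1(\eta_1')^{-1}(\varepsilon_1|\nu_1|)\,\mathrm{sgn}(\nu_1),\qquad \omega^*=-\varepsilon_2(\eta_2')^{-1}(\varepsilon_2|\nu_2|)\,\mathrm{sgn}(\nu_2).$$ That is, under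 this feedback a trajectory on $[0,\infty)$ exists from each initial condition in $\{\rho>0\}\times\mathbb R^2$, each trajectory on a bounded interval $[0,T)$ extends to one on $[0,\infty)$, and each closed-loop trajectory on $[0,\infty)$ has a finite cost, which is at most the cost of any such competing controls with the same initial condition. (c) The feedback law $$v=-\rho\,\varepsilon_1\frac{\ell\eta_1(\varepsilon_1|\nu_1|)}{\varepsilon_1|\nu_1|}\,\mathrm{sgn}(\nu_1),\qquad \omega=-\varepsilon_2\frac{\ell\eta_2(\varepsilon_2|\nu_2|)}{\varepsilon_2|\nu_2|}\,\mathrm{sgn}(\nu_2)$$ (read as $0$ where $\nu_1=0$, respectively $\nu_2=0$) is continuous in $(\nu_1,\nu_2)$ and renders the origin $\rho=\delta=\gamma=0$ globally asymptotically stable on $\{\rho>0\}\times\mathbb R^2$: from each initial condition a closed-loop trajectory on $[0,\infty)$ exists, each closed-loop trajectory on a bounded interval $[0,T)$ extends to one on $[0,\infty)$, and, for all closed-loop trajectories, the origin is Lyapunov stable and globally attractive. -/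

import Mathlib

open Set Filter Topology MeasureTheory

namespace Unicycle

noncomputable section

/-- The state `Ξ = (ρ, δ, γ)`: distance to the origin, polar angle, line-of-sight angle. -/
abbrev State : Type := ℝ × ℝ × ℝ

/-- The state space `{ρ > 0} × ℝ²`. -/
def stateSpace : Set State := {Ξ | 0 < Ξ.1}

/-- The closure `{ρ ≥ 0} × ℝ²` of the state space; it contains the origin. -/
def closedStateSpace : Set State := {Ξ | 0 ≤ Ξ.1}

/-- The rescaled input vector field `ḡ₁ = (-ρ cos γ, sin γ, sin γ)`. -/
def gbar₁ (Ξ : State) : State :=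
  (-Ξ.1 * Real.cos Ξ.2.2, Real.sin Ξ.2.2, Real.sin Ξ.2.2)

/-- The steering vector field `g₂ = (0, 0, -1)`. -/
def g₂ (_Ξ : State) : State := (0, 0, -1)

/-- Right-hand side of the control system `Ξ' = ḡ₁(Ξ) (v / ρ) + g₂(Ξ) ω`. -/
def rhs (Ξ : State) (v ω : ℝ) : State := (v / Ξ.1) • gbar₁ Ξ + ω • g₂ Ξ

/-- The control Lyapunov function `V = ρ² + δ² + (γ + (1/2) arctan (2δ))²`. -/
def V (Ξ : State) : ℝ :=
  Ξ.1 ^ 2 + Ξ.2.1 ^ 2 + (Ξ.2.2 + 1 / 2 * Real.arctan (2 * Ξ.2.1)) ^ 2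

/-- The Lie derivative `L_g W` of a function `W` along a vector field `g`. -/
def lieDeriv (g : State → State) (W : State → ℝ) (Ξ : State) : ℝ := fderiv ℝ W Ξ (g Ξ)

/-- `ν₁ = L_{ḡ₁} V`. -/
def ν₁ : State → ℝ := lieDeriv gbar₁ V

/-- `ν₂ = L_{g₂} V`. -/
def ν₂ : State → ℝ := lieDeriv g₂ V

/-! ### Class `K_∞` functions on `[0, a)` and the Legendre–Fenchel transform -/

/-- The real interval `[0, a)`, where `a` may be `⊤`. -/
def dom (a : EReal) : Set ℝ := {r | 0 ≤ r ∧ (r : EReal) < a}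

/-- `f` is of class `K_∞` on `[0, a)`: continuous, strictly increasing, zero at zero and unbounded
(equivalently, by monotonicity, `f r → ∞` as `r → a`). -/
structure IsClassKInf (a : EReal) (f : ℝ → ℝ) : Prop where
  continuousOn : ContinuousOn f (dom a)
  strictMonoOn : StrictMonoOn f (dom a)
  map_zero : f 0 = 0
  unbounded : ∀ M : ℝ, ∃ r ∈ dom a, M ≤ f r

/-- The derivative `η'` on `[0, a)` (one-sided at `0`). -/
def der (a : EReal) (η : ℝ → ℝ) : ℝ → ℝ := derivWithin η (dom a)

/-- `η` and its derivative `η'` are both of class `K_∞` on `[0, a)`. -/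
structure IsControlPenalty (a : EReal) (η : ℝ → ℝ) : Prop where
  differentiableOn : DifferentiableOn ℝ η (dom a)
  kInf : IsClassKInf a η
  kInf_der : IsClassKInf a (der a η)

/-- The inverse `(η')⁻¹ : [0, ∞) → [0, a)` of `η' : [0, a) → [0, ∞)`. -/
def derInv (a : EReal) (η : ℝ → ℝ) : ℝ → ℝ := Function.invFunOn (der a η) (dom a)

/-- The Legendre–Fenchel transform `ℓη(r) = ∫₀ʳ (η')⁻¹(s) ds`. -/
def legendre (a : EReal) (η : ℝ → ℝ) (r : ℝ) : ℝ := ∫ s in (0 : ℝ)..r, derInv a η s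

/-! ### Trajectories -/

/-- `Ξ` is a (Carathéodory) trajectory on the time interval `J ∋ 0`, inside the state space, for the
controls `v, ω`: it is locally absolutely continuous and satisfies the differential equation almost
everywhere, in integrated form. As `ρ > 0` along `Ξ`, the integrability below makes `v` and `ω`
measurable and locally integrable on `J`. -/
structure IsTrajectoryOn (J : Set ℝ) (v ω : ℝ → ℝ) (Ξ : ℝ → State) : Prop where
  mem : ∀ t ∈ J, Ξ t ∈ stateSpace
  integrable : ∀ t ∈ J,
    IntervalIntegrable (fun s => rhs (Ξ s) (v s) (ω s)) volume 0 t
  eq_integral : ∀ t ∈ J, Ξ t = Ξ 0 + ∫ s in (0 : ℝ)..t, rhs (Ξ s) (v s) (ω s)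

/-- `Ξ` is a trajectory on `J` of the closed loop under the state feedback `v = k₁ Ξ`, `ω = k₂ Ξ`. -/
def IsClosedLoopOn (J : Set ℝ) (k₁ k₂ : State → ℝ) (Ξ : ℝ → State) : Prop :=
  IsTrajectoryOn J (fun t => k₁ (Ξ t)) (fun t => k₂ (Ξ t)) Ξ

/-- The closed loop is forward complete: from each initial state there is a trajectory on `[0, ∞)`,
and each trajectory on a bounded interval `[0, T)` is the restriction of one on `[0, ∞)`. -/
structure IsForwardComplete (k₁ k₂ : State → ℝ) : Prop where
  exists_trajectory : ∀ Ξ₀ ∈ stateSpace, ∃ Ξ : ℝ → State,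
    Ξ 0 = Ξ₀ ∧ IsClosedLoopOn (Ici 0) k₁ k₂ Ξ
  extends_trajectory : ∀ T > (0 : ℝ), ∀ Ξ : ℝ → State, IsClosedLoopOn (Ico 0 T) k₁ k₂ Ξ →
    ∃ Ξ' : ℝ → State, EqOn Ξ' Ξ (Ico 0 T) ∧ IsClosedLoopOn (Ici 0) k₁ k₂ Ξ'

/-- The feedback `(k₁, k₂)` renders the origin globally asymptotically stable on
`{ρ > 0} × ℝ²`: the closed loop is forward complete, and the origin is Lyapunov stable and globally
attractive. Closed-loop trajectories need not be unique, so all of them are considered. -/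
structure IsGAS (k₁ k₂ : State → ℝ) : Prop where
  forwardComplete : IsForwardComplete k₁ k₂
  stable : ∀ e > (0 : ℝ), ∃ d > (0 : ℝ), ∀ Ξ : ℝ → State,
    IsClosedLoopOn (Ici 0) k₁ k₂ Ξ → ‖Ξ 0‖ < d → ∀ t ≥ (0 : ℝ), ‖Ξ t‖ < e
  attractive : ∀ Ξ : ℝ → State,
    IsClosedLoopOn (Ici 0) k₁ k₂ Ξ → Tendsto Ξ atTop (𝓝 0)

/-! ### The cost functional -/

/-- The state penalty `l = ℓη₁(ε₁|ν₁|) + ℓη₂(ε₂|ν₂|)`. -/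
def statePenalty (a₁ a₂ : EReal) (η₁ η₂ : ℝ → ℝ) (ε₁ ε₂ : State → ℝ) (Ξ : State) : ℝ :=
  legendre a₁ η₁ (ε₁ Ξ * |ν₁ Ξ|) + legendre a₂ η₂ (ε₂ Ξ * |ν₂ Ξ|)

open Classical in
/-- The control penalty `η(r)`, which is `+∞` where `r` is outside the domain `[0, a)` of `η`. -/
def controlPenalty (a : EReal) (η : ℝ → ℝ) (r : ℝ) : ENNReal :=
  if r ∈ dom a then ENNReal.ofReal (η r) else ⊤

/-- The cost
`J = ∫₀^∞ [l(Ξ) + η₁(|v| / (ε₁ ρ)) + η₂(|ω| / ε₂)] dt ∈ [0, ∞]`. -/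
def cost (a₁ a₂ : EReal) (η₁ η₂ : ℝ → ℝ) (ε₁ ε₂ : State → ℝ)
    (v ω : ℝ → ℝ) (Ξ : ℝ → State) : ENNReal :=
  ∫⁻ t in Ici (0 : ℝ),
    (ENNReal.ofReal (statePenalty a₁ a₂ η₁ η₂ ε₁ ε₂ (Ξ t))
      + controlPenalty a₁ η₁ (|v t| / (ε₁ (Ξ t) * (Ξ t).1))
      + controlPenalty a₂ η₂ (|ω t| / ε₂ (Ξ t)))

/-- The feedback `(k₁, k₂)` minimizes the cost for all initial conditions in the state space: the
closed loop is forward complete, and each closed-loop trajectory on `[0, ∞)` has a finite cost, which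
is at most the cost of any controls `v, ω` with a trajectory on `[0, ∞)` from the same initial
state. -/
structure IsMinimizing (a₁ a₂ : EReal) (η₁ η₂ : ℝ → ℝ) (ε₁ ε₂ : State → ℝ)
    (k₁ k₂ : State → ℝ) : Prop where
  forwardComplete : IsForwardComplete k₁ k₂
  cost_lt_top : ∀ Ξ : ℝ → State, IsClosedLoopOn (Ici 0) k₁ k₂ Ξ →
    cost a₁ a₂ η₁ η₂ ε₁ ε₂ (fun t => k₁ (Ξ t)) (fun t => k₂ (Ξ t)) Ξ < ⊤
  cost_le : ∀ Ξ : ℝ → State, IsClosedLoopOn (Ici 0) k₁ k₂ Ξ →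
    ∀ (v ω : ℝ → ℝ) (Ξ' : ℝ → State), IsTrajectoryOn (Ici 0) v ω Ξ' → Ξ' 0 = Ξ 0 →
      cost a₁ a₂ η₁ η₂ ε₁ ε₂ (fun t => k₁ (Ξ t)) (fun t => k₂ (Ξ t)) Ξ
        ≤ cost a₁ a₂ η₁ η₂ ε₁ ε₂ v ω Ξ'

/-! ### The feedback laws -/

/-- `v* = -ρ ε₁ (η₁')⁻¹(ε₁|ν₁|) sgn ν₁`. -/
def vStar (a : EReal) (η : ℝ → ℝ) (ε : State → ℝ) (Ξ : State) : ℝ :=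
  -Ξ.1 * ε Ξ * derInv a η (ε Ξ * |ν₁ Ξ|) * Real.sign (ν₁ Ξ)

/-- `ω* = -ε₂ (η₂')⁻¹(ε₂|ν₂|) sgn ν₂`. -/
def ωStar (a : EReal) (η : ℝ → ℝ) (ε : State → ℝ) (Ξ : State) : ℝ :=
  -ε Ξ * derInv a η (ε Ξ * |ν₂ Ξ|) * Real.sign (ν₂ Ξ)

/-- `v = -ρ ε ℓη(ε|ν|) / (ε|ν|) sgn ν` with the values `ρ`, `ε`, `ν` as variables; it is `0` at
`ν = 0`. -/
def vLaw (a : EReal) (η : ℝ → ℝ) (ρ ε ν : ℝ) : ℝ :=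
  -ρ * ε * (legendre a η (ε * |ν|) / (ε * |ν|)) * Real.sign ν

/-- `ω = -ε ℓη(ε|ν|) / (ε|ν|) sgn ν` with the values `ε`, `ν` as variables; it is `0` at
`ν = 0`. -/
def ωLaw (a : EReal) (η : ℝ → ℝ) (ε ν : ℝ) : ℝ :=
  -ε * (legendre a η (ε * |ν|) / (ε * |ν|)) * Real.sign ν

end

end Unicycle

open Unicycle

namespace Unicycle

/-! ### Control penalties and their Legendre–Fenchel transforms -/

section Penalty

variable {a : EReal} {η : ℝ → ℝ}

/-! Along any trajectory `V` is absolutely continuous, with derivative `ν₁ (v/ρ) + ν₂ ω`. Young's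
inequality for the pair `η`, `ℓη`, applied to `(ε₁|ν₁|) · (|v|/(ε₁ρ))` and `(ε₂|ν₂|) · (|ω|/ε₂)`,
bounds the absolute value of this derivative by the running cost. For the starred feedback it holds
with equality and the running cost is exactly `-dV/dt`.

Optimality is therefore a comparison of both costs with `V (Ξ 0)`. The closed-loop cost up to time
`n` is `V (Ξ 0) - V (Ξ n)`, so the total is at most `V (Ξ 0)` (`cost_le_ofReal_V`). Conversely, a
competitor of cost `j < V (Ξ 0)` could change `V` by at most `j`, so it would stay in a compact
shell away from the origin; the state penalty has a positive minimum there, which makes the cost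
infinite (`ofReal_V_le_cost`). No convergence of trajectories is needed.

For the companion feedback, `dV/dt` equals minus the state penalty, and stability and attractivity
follow from positive definiteness (`eq_zero_of_ν_eq_zero`) and properness of `V`
(`norm_le_two_mul_sqrt_V`).

Both feedbacks have the form `v = ρ c₁`, `ω = c₂` with `c₁`, `c₂` continuous up to `ρ = 0`, hence
only Peano existence is available. In the coordinate `log ρ` the field is bounded on sublevel sets
of `V`, so solutions neither blow up nor reach `ρ = 0` in finite time
(`isForwardComplete_of_nonpos`). -/

lemma ordConnected_dom (a : EReal) : (dom a).OrdConnected :=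
  ⟨fun _ hx _ hy _ hz =>
    ⟨hx.1.trans hz.1, lt_of_le_of_lt (EReal.coe_le_coe_iff.2 hz.2) hy.2⟩⟩

lemma isOpen_coe_lt (a : EReal) : IsOpen {r : ℝ | (r : EReal) < a} :=
  isOpen_Iio.preimage continuous_coe_real_ereal

lemma dom_mem_nhds {r : ℝ} (hr : r ∈ dom a) (h0 : 0 < r) : dom a ∈ 𝓝 r :=
  inter_mem (Ici_mem_nhds h0) ((isOpen_coe_lt a).mem_nhds hr.2)

lemma dom_mem_nhdsGE {r : ℝ} (hr : r ∈ dom a) : dom a ∈ 𝓝[≥] r :=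
  inter_mem (mem_of_superset self_mem_nhdsWithin (Ici_subset_Ici.2 hr.1))
    (mem_nhdsWithin_of_mem_nhds ((isOpen_coe_lt a).mem_nhds hr.2))

namespace IsClassKInf

variable {f : ℝ → ℝ}

lemma zero_mem (h : IsClassKInf a f) : (0 : ℝ) ∈ dom a := by
  obtain ⟨r, hr, -⟩ := h.unbounded 0
  exact ⟨le_rfl, lt_of_le_of_lt (EReal.coe_le_coe_iff.2 hr.1) hr.2⟩

lemma nonneg (h : IsClassKInf a f) {r : ℝ} (hr : r ∈ dom a) : 0 ≤ f r := by
  rw [← h.map_zero]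
  exact h.strictMonoOn.monotoneOn h.zero_mem hr hr.1

lemma surjOn (h : IsClassKInf a f) : SurjOn f (dom a) (Ici 0) := by
  intro s hs
  obtain ⟨r, hr, hsr⟩ := h.unbounded s
  have hsub : Icc 0 r ⊆ dom a := (ordConnected_dom a).out h.zero_mem hr
  obtain ⟨x, hx, rfl⟩ := intermediate_value_Icc hr.1 (h.continuousOn.mono hsub)
    (show s ∈ Icc (f 0) (f r) from ⟨by rw [h.map_zero]; exact hs, hsr⟩)
  exact ⟨x, hsub hx, rfl⟩

end IsClassKInf

namespace IsControlPenalty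

lemma derInv_mem (h : IsControlPenalty a η) {s : ℝ} (hs : 0 ≤ s) : derInv a η s ∈ dom a :=
  Function.invFunOn_mem (h.kInf_der.surjOn hs)

lemma der_derInv (h : IsControlPenalty a η) {s : ℝ} (hs : 0 ≤ s) :
    der a η (derInv a η s) = s :=
  Function.invFunOn_eq (h.kInf_der.surjOn hs)

lemma derInv_nonneg (h : IsControlPenalty a η) {s : ℝ} (hs : 0 ≤ s) : 0 ≤ derInv a η s :=
  (h.derInv_mem hs).1

lemma derInv_der (h : IsControlPenalty a η) {r : ℝ} (hr : r ∈ dom a) :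
    derInv a η (der a η r) = r :=
  h.kInf_der.strictMonoOn.injOn (h.derInv_mem (h.kInf_der.nonneg hr)) hr
    (h.der_derInv (h.kInf_der.nonneg hr))

lemma derInv_zero (h : IsControlPenalty a η) : derInv a η 0 = 0 := by
  have := h.derInv_der h.kInf_der.zero_mem
  rwa [h.kInf_der.map_zero] at this

lemma strictMonoOn_derInv (h : IsControlPenalty a η) : StrictMonoOn (derInv a η) (Ici 0) := by
  intro s hs t ht hst
  rw [← h.kInf_der.strictMonoOn.lt_iff_lt (h.derInv_mem hs) (h.derInv_mem ht),
    h.der_derInv hs, h.der_derInv ht]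
  exact hst

lemma image_derInv (h : IsControlPenalty a η) : derInv a η '' Ici 0 = dom a :=
  Subset.antisymm (image_subset_iff.2 fun _ hs => h.derInv_mem hs)
    fun _ hr => ⟨_, h.kInf_der.nonneg hr, h.derInv_der hr⟩

/-- A monotone function can only jump over values. The image here is all of `dom a`, a neighbourhood
of each of its points, one-sided at `0`. -/
lemma continuousOn_derInv (h : IsControlPenalty a η) : ContinuousOn (derInv a η) (Ici 0) := by
  intro s hs
  rcases (show (0 : ℝ) ≤ s from hs).eq_or_lt with rfl | hpos
  · refine h.strictMonoOn_derInv.continuousWithinAt_right_of_image_mem_nhdsWithin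
      self_mem_nhdsWithin ?_
    rw [h.image_derInv]
    exact dom_mem_nhdsGE (h.derInv_mem le_rfl)
  · refine (h.strictMonoOn_derInv.continuousAt_of_image_mem_nhds (Ici_mem_nhds hpos)
      ?_).continuousWithinAt
    rw [h.image_derInv]
    refine dom_mem_nhds (h.derInv_mem hs) ?_
    rw [← h.derInv_zero]
    exact h.strictMonoOn_derInv (mem_Ici.2 le_rfl) hs hpos

lemma hasDerivAt (h : IsControlPenalty a η) {r : ℝ} (hr : r ∈ dom a) (h0 : 0 < r) :
    HasDerivAt η (der a η r) r :=
  ((h.differentiableOn r hr).hasDerivWithinAt).hasDerivAt (dom_mem_nhds hr h0)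

/-- `η` lies above its tangent lines. -/
lemma tangent_le (h : IsControlPenalty a η) {x y : ℝ} (hx : x ∈ dom a) (hy : y ∈ dom a) :
    η y + der a η y * (x - y) ≤ η x := by
  have key : ∀ {u w : ℝ}, u ∈ dom a → w ∈ dom a → u < w →
      ∃ c ∈ Ioo u w, c ∈ dom a ∧ η w - η u = der a η c * (w - u) := by
    intro u w hu hw huw
    have hsub : Icc u w ⊆ dom a := (ordConnected_dom a).out hu hw
    obtain ⟨c, hc, hc'⟩ := exists_hasDerivAt_eq_slope η (der a η) huw
      (h.kInf.continuousOn.mono hsub)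
      fun z hz => h.hasDerivAt (hsub (Ioo_subset_Icc_self hz)) (hu.1.trans_lt hz.1)
    refine ⟨c, hc, hsub (Ioo_subset_Icc_self hc), ?_⟩
    rw [hc', div_mul_cancel₀ _ (sub_pos.2 huw).ne']
  rcases lt_trichotomy x y with hxy | rfl | hxy
  · obtain ⟨c, hc, hcd, he⟩ := key hx hy hxy
    nlinarith [h.kInf_der.strictMonoOn hcd hy hc.2]
  · simp
  · obtain ⟨c, hc, hcd, he⟩ := key hy hx hxy
    nlinarith [h.kInf_der.strictMonoOn hy hcd hc.1]

lemma mul_sub_le (h : IsControlPenalty a η) {r x : ℝ} (hr : 0 ≤ r) (hx : x ∈ dom a) :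
    r * x - η x ≤ r * derInv a η r - η (derInv a η r) := by
  have := h.tangent_le hx (h.derInv_mem hr)
  rw [h.der_derInv hr] at this
  linarith

/-- The conjugate `r (η')⁻¹(r) - η((η')⁻¹(r))` has right derivative `(η')⁻¹`. -/
lemma hasDerivWithinAt_conj (h : IsControlPenalty a η) {r : ℝ} (hr : 0 ≤ r) :
    HasDerivWithinAt (fun r => r * derInv a η r - η (derInv a η r)) (derInv a η r) (Ioi r) r := by
  rw [hasDerivWithinAt_iff_tendsto_slope' self_notMem_Ioi]
  have hφ : Tendsto (derInv a η) (𝓝[>] r) (𝓝 (derInv a η r)) :=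
    ((h.continuousOn_derInv r hr).mono fun x hx => hr.trans (le_of_lt hx)).tendsto
  -- `(η')⁻¹` need not be differentiable, so the product rule is unavailable. Maximality of the
  -- conjugate at `r` and at `t` traps the slope between `(η')⁻¹(r)` and `(η')⁻¹(t)`.
  refine tendsto_of_tendsto_of_tendsto_of_le_of_le' tendsto_const_nhds hφ ?_ ?_
  all_goals
    filter_upwards [self_mem_nhdsWithin] with t ht
    have ht' : r < t := ht
    have h0 : 0 ≤ t := hr.trans ht'.le
    rw [slope_def_field]
  · rw [le_div_iff₀ (sub_pos.2 ht')]
    linarith [h.mul_sub_le h0 (h.derInv_mem hr)]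
  · rw [div_le_iff₀ (sub_pos.2 ht')]
    linarith [h.mul_sub_le hr (h.derInv_mem h0)]

lemma intervalIntegrable_derInv (h : IsControlPenalty a η) {r s : ℝ} (hr : 0 ≤ r) (hs : 0 ≤ s) :
    IntervalIntegrable (derInv a η) volume r s :=
  (h.continuousOn_derInv.mono fun _ hx => (le_inf hr hs).trans hx.1).intervalIntegrable

lemma legendre_eq (h : IsControlPenalty a η) {r : ℝ} (hr : 0 ≤ r) :
    legendre a η r = r * derInv a η r - η (derInv a η r) := by
  have hcont : ContinuousOn (fun r => r * derInv a η r - η (derInv a η r)) (Icc 0 r) :=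
    (((continuousOn_id.mul h.continuousOn_derInv).sub
      (h.kInf.continuousOn.comp h.continuousOn_derInv fun _ hs => h.derInv_mem hs))).mono
      Icc_subset_Ici_self
  rw [legendre, intervalIntegral.integral_eq_sub_of_hasDeriv_right_of_le hr hcont
    (fun x hx => h.hasDerivWithinAt_conj hx.1.le) (h.intervalIntegrable_derInv le_rfl hr)]
  simp [h.derInv_zero, h.kInf.map_zero]

/-- Young's inequality. -/
lemma mul_le_legendre_add (h : IsControlPenalty a η) {r x : ℝ} (hr : 0 ≤ r) (hx : x ∈ dom a) :
    r * x ≤ legendre a η r + η x := by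
  rw [h.legendre_eq hr]
  linarith [h.mul_sub_le hr hx]

/-- The equality case of Young's inequality. -/
lemma legendre_add_eq (h : IsControlPenalty a η) {r : ℝ} (hr : 0 ≤ r) :
    legendre a η r + η (derInv a η r) = r * derInv a η r := by
  rw [h.legendre_eq hr]
  ring

lemma legendre_zero (a : EReal) (η : ℝ → ℝ) : legendre a η 0 = 0 := by simp [legendre]

lemma legendre_pos (h : IsControlPenalty a η) {r : ℝ} (hr : 0 < r) : 0 < legendre a η r := by
  refine intervalIntegral.intervalIntegral_pos_of_pos_on
    (h.intervalIntegrable_derInv le_rfl hr.le) (fun x hx => ?_) hr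
  have := h.strictMonoOn_derInv (mem_Ici.2 le_rfl) (show x ∈ Ici (0 : ℝ) from hx.1.le) hx.1
  rwa [h.derInv_zero] at this

lemma legendre_nonneg (h : IsControlPenalty a η) {r : ℝ} (hr : 0 ≤ r) : 0 ≤ legendre a η r := by
  rcases hr.eq_or_lt with rfl | hr
  · rw [legendre_zero]
  · exact (h.legendre_pos hr).le

lemma legendre_eq_zero_iff (h : IsControlPenalty a η) {r : ℝ} (hr : 0 ≤ r) :
    legendre a η r = 0 ↔ r = 0 := by
  refine ⟨fun h0 => ?_, fun h0 => by rw [h0, legendre_zero]⟩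
  by_contra hne
  exact (h.legendre_pos (lt_of_le_of_ne hr (Ne.symm hne))).ne' h0

lemma legendre_le (h : IsControlPenalty a η) {r : ℝ} (hr : 0 ≤ r) :
    legendre a η r ≤ r * derInv a η r := by
  rw [h.legendre_eq hr]
  linarith [h.kInf.nonneg (h.derInv_mem hr)]

lemma continuousOn_legendre (h : IsControlPenalty a η) :
    ContinuousOn (legendre a η) (Ici 0) := by
  refine ContinuousOn.congr ?_ fun r hr => h.legendre_eq hr
  exact (continuousOn_id.mul h.continuousOn_derInv).sub
    (h.kInf.continuousOn.comp h.continuousOn_derInv fun _ hs => h.derInv_mem hs)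

lemma continuousOn_legendre_div (h : IsControlPenalty a η) :
    ContinuousOn (fun r => legendre a η r / r) (Ici 0) := by
  intro r hr
  rcases (show (0 : ℝ) ≤ r from hr).eq_or_lt with rfl | hpos
  · have hφ := (h.continuousOn_derInv 0 hr).tendsto
    rw [h.derInv_zero] at hφ
    -- The convention `x / 0 = 0` gives the correct limit value, as `0 ≤ ℓη(t)/t ≤ (η')⁻¹(t) → 0`.
    rw [ContinuousWithinAt, div_zero]
    refine tendsto_of_tendsto_of_tendsto_of_le_of_le' tendsto_const_nhds hφ ?_ ?_
    all_goals filter_upwards [self_mem_nhdsWithin] with t ht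
    · exact div_nonneg (h.legendre_nonneg ht) ht
    · exact div_le_of_le_mul₀ ht (h.derInv_nonneg ht) (by
        rw [mul_comm]; exact h.legendre_le ht)
  · exact (h.continuousOn_legendre r hr).div continuousWithinAt_id hpos.ne'

end IsControlPenalty

/-- The odd extension of a continuous function on `[0, ∞)` vanishing at `0` is continuous. -/
lemma continuous_odd_extension {g : ℝ → ℝ} (hg : ContinuousOn g (Ici 0)) (h0 : g 0 = 0) :
    Continuous fun x => g |x| * Real.sign x := by
  have hcomp : Continuous fun x => g |x| :=
    hg.comp_continuous continuous_abs fun x => abs_nonneg x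
  have h1 : Continuous fun x => if 0 ≤ x then g |x| else -g |x| :=
    hcomp.if_le hcomp.neg continuous_const continuous_id fun x hx => by
      simp [← hx, h0]
  refine h1.congr fun x => ?_
  rcases lt_trichotomy x 0 with hx | rfl | hx
  · rw [if_neg (not_le.2 hx), Real.sign_of_neg hx]; ring
  · simp [h0]
  · rw [if_pos hx.le, Real.sign_of_pos hx]; ring

/-- An odd feedback profile `g(ε|ν|) sgn ν` depends continuously on the gain `ε > 0` and on `ν`. -/
lemma continuousOn_odd_profile {g : ℝ → ℝ} (hg : ContinuousOn g (Ici 0)) (h0 : g 0 = 0)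
    {X : Type*} [TopologicalSpace X] {s : Set X} {e n : X → ℝ} (he : ContinuousOn e s)
    (hn : ContinuousOn n s) (hpos : ∀ x ∈ s, 0 < e x) :
    ContinuousOn (fun x => g (e x * |n x|) * Real.sign (n x)) s := by
  refine ((continuous_odd_extension hg h0).comp_continuousOn (he.mul hn)).congr fun x hx => ?_
  have hx := hpos x hx
  have hs : Real.sign (e x * n x) = Real.sign (n x) := by
    rcases lt_trichotomy (n x) 0 with h | h | h
    · rw [Real.sign_of_neg h, Real.sign_of_neg (mul_neg_of_pos_of_neg hx h)]
    · simp [h]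
    · rw [Real.sign_of_pos h, Real.sign_of_pos (mul_pos hx h)]
  simp only [Function.comp, Pi.mul_apply, abs_mul, abs_of_pos hx, hs]

lemma mul_sign_eq_abs (x : ℝ) : x * Real.sign x = |x| := by
  rcases lt_trichotomy x 0 with h | h | h
  · rw [Real.sign_of_neg h, abs_of_neg h]; ring
  · simp [h]
  · rw [Real.sign_of_pos h, abs_of_pos h]; ring

end Penalty

/-! ### Existence of solutions for bounded continuous vector fields -/

section Peano

variable {E : Type*} [NormedAddCommGroup E] [NormedSpace ℝ E]

/-- The Euler polygon of the vector field `F` with step `h`, at its nodes. -/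
noncomputable def eulerNode (F : E → E) (x₀ : E) (h : ℝ) : ℕ → E
  | 0 => x₀
  | k + 1 => eulerNode F x₀ h k + h • F (eulerNode F x₀ h k)

/-- The error per step is at most `h * e`, and errors add up. With `w = 0` this yields the Lipschitz
bound; with `w` the field at a limit point it yields the derivative. -/
lemma norm_eulerNode_sub_le {F : E → E} {x₀ : E} {h : ℝ} (hh : 0 ≤ h) {w : E} {e : ℝ} {k m : ℕ}
    (hkm : k ≤ m) (hF : ∀ j, k ≤ j → j < m → ‖F (eulerNode F x₀ h j) - w‖ ≤ e) :
    ‖eulerNode F x₀ h m - eulerNode F x₀ h k - (((m : ℝ) - k) * h) • w‖ ≤ ((m : ℝ) - k) * h * e := by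
  induction m, hkm using Nat.le_induction with
  | base => simp
  | succ m hkm ih =>
    have h1 := ih fun j hj hjm => hF j hj (hjm.trans m.lt_succ_self)
    have h2 : ‖h • (F (eulerNode F x₀ h m) - w)‖ ≤ h * e := by
      rw [norm_smul, Real.norm_of_nonneg hh]
      exact mul_le_mul_of_nonneg_left (hF m hkm m.lt_succ_self) hh
    have h3 : eulerNode F x₀ h (m + 1) - eulerNode F x₀ h k - (((m + 1 : ℕ) : ℝ) - k) • h • w
        = (eulerNode F x₀ h m - eulerNode F x₀ h k - ((m : ℝ) - k) • h • w)
          + h • (F (eulerNode F x₀ h m) - w) := by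
      rw [eulerNode]
      push_cast
      module
    rw [mul_smul] at h1 ⊢
    rw [h3]
    refine (norm_add_le _ _).trans ((add_le_add h1 h2).trans_eq ?_)
    push_cast
    ring

/-- **Peano's theorem** for a bounded continuous vector field, with a global solution. -/
theorem exists_hasDerivWithinAt_of_bounded [ProperSpace E] {F : E → E} (hF : Continuous F) {L : ℝ}
    (hL : ∀ x, ‖F x‖ ≤ L) (x₀ : E) :
    ∃ x : ℝ → E, x 0 = x₀ ∧ ContinuousOn x (Ici 0) ∧
      ∀ t ≥ (0 : ℝ), HasDerivWithinAt x (F (x t)) (Ici t) t := by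
  have hL0 : 0 ≤ L := (norm_nonneg _).trans (hL x₀)
  let h : ℕ → ℝ := fun n => 1 / ((n : ℝ) + 1)
  let N : ℕ → ℝ → ℕ := fun n t => ⌊t * ((n : ℝ) + 1)⌋₊
  -- A step-function version of the polygon: the value at the last node before `t`. Its jumps vanish
  -- in the limit, so no interpolation is needed.
  let X : ℕ → ℝ → E := fun n t => eulerNode F x₀ (h n) (N n t)
  have hh : ∀ n, 0 ≤ h n := fun n => by positivity
  have hmono : ∀ n {s t : ℝ}, s ≤ t → N n s ≤ N n t := fun n s t hst =>
    Nat.floor_mono (mul_le_mul_of_nonneg_right hst (by positivity))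
  have hNlim : ∀ t, 0 ≤ t → Tendsto (fun n => (N n t : ℝ) * h n) atTop (𝓝 t) := fun t ht => by
    have h1 : Tendsto (fun n : ℕ => (n : ℝ) + 1) atTop atTop :=
      tendsto_atTop_add_const_right _ _ tendsto_natCast_atTop_atTop
    refine ((tendsto_nat_floor_mul_div_atTop ht).comp h1).congr fun n => ?_
    simp [N, h, div_eq_mul_inv]
  have hlip : ∀ n {s t : ℝ}, s ≤ t →
      ‖X n t - X n s‖ ≤ ((N n t : ℝ) - N n s) * h n * L := fun n s t hst => by
    simpa using norm_eulerNode_sub_le (F := F) (x₀ := x₀) (hh n) (w := 0) (hmono n hst)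
      fun j _ _ => by simpa using hL (eulerNode F x₀ (h n) j)
  have hN0 : ∀ n, N n 0 = 0 := fun n => by simp [N]
  have hX0 : ∀ n, X n 0 = x₀ := fun n => by simp only [X, hN0]; rfl
  have hball : ∀ t n, X n t ∈ Metric.closedBall x₀ (max t 0 * L) := fun t n => by
    rw [mem_closedBall_iff_norm]
    have key : ∀ t, 0 ≤ t → ‖X n t - x₀‖ ≤ t * L := fun t ht => by
      have := hlip n ht
      rw [hX0, hN0, Nat.cast_zero, sub_zero] at this
      refine this.trans (mul_le_mul_of_nonneg_right ?_ hL0)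
      simp only [h, mul_one_div]
      rw [div_le_iff₀ (by positivity)]
      exact Nat.floor_le (by positivity)
    rcases le_total 0 t with ht | ht
    · rw [max_eq_left ht]
      exact key t ht
    · have : X n t = x₀ := by
        have : N n t = 0 := Nat.floor_of_nonpos (mul_nonpos_of_nonpos_of_nonneg ht (by positivity))
        simp only [X, this]; rfl
      rw [this]
      simp [ht]
  -- A nonprincipal ultrafilter gives limits at all times simultaneously and replaces the
  -- Arzelà–Ascoli subsequence.
  let U : Ultrafilter ℕ := hyperfilter ℕ
  have hUle : (U : Filter ℕ) ≤ atTop := by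
    rw [← Nat.cofinite_eq_atTop]; exact hyperfilter_le_cofinite
  have hlim : ∀ t, ∃ y, Tendsto (fun n => X n t) U (𝓝 y) := fun t => by
    obtain ⟨y, -, hy⟩ := (isCompact_closedBall x₀ (max t 0 * L)).ultrafilter_le_nhds
      (U.map fun n => X n t) (by
        rw [le_principal_iff]
        exact Filter.mem_map.2 (univ_mem' (hball t)))
    exact ⟨y, hy⟩
  choose x hx using hlim
  have hgap : ∀ {s t : ℝ}, 0 ≤ s → s ≤ t →
      Tendsto (fun n => ((N n t : ℝ) - N n s) * h n) U (𝓝 (t - s)) := fun {s t} hs hst => by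
    refine (((hNlim t (hs.trans hst)).sub (hNlim s hs)).mono_left hUle).congr fun n => ?_
    ring
  have hxlip : ∀ {s t : ℝ}, 0 ≤ s → s ≤ t → ‖x t - x s‖ ≤ (t - s) * L := fun {s t} hs hst =>
    le_of_tendsto_of_tendsto ((hx t).sub (hx s)).norm ((hgap hs hst).mul_const L)
      (Filter.Eventually.of_forall fun n => hlip n hst)
  refine ⟨x, ?_, ?_, ?_⟩
  · refine tendsto_nhds_unique (hx 0) ?_
    simp only [hX0]
    exact tendsto_const_nhds
  · refine (LipschitzOnWith.of_dist_le_mul (K := L.toNNReal) fun s hs t ht => ?_).continuousOn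
    rw [Real.coe_toNNReal L hL0, mul_comm]
    rcases le_total s t with hst | hst
    · rw [dist_comm, dist_eq_norm, dist_comm, Real.dist_eq, abs_of_nonneg (sub_nonneg.2 hst)]
      exact hxlip hs hst
    · rw [dist_eq_norm, Real.dist_eq, abs_of_nonneg (sub_nonneg.2 hst)]
      exact hxlip ht hst
  · intro s hs
    rw [hasDerivWithinAt_iff_isLittleO, Asymptotics.isLittleO_iff]
    intro e he
    obtain ⟨d, hd, hdF⟩ := Metric.continuous_iff.1 hF (x s) e he
    -- On this window the polygon moves less than `d / 2`, and `X n s` is eventually within `d / 2`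
    -- of `x s`, so the field at all nodes used is `e`-close to `F (x s)`. The `+ 1` covers `L = 0`.
    have hIco : Ico s (s + d / (2 * (L + 1))) ∈ 𝓝[≥] s :=
      Ico_mem_nhdsGE (lt_add_of_pos_right _ (by positivity))
    filter_upwards [hIco] with t ht
    have hst : s ≤ t := ht.1
    rw [Real.norm_of_nonneg (sub_nonneg.2 hst)]
    have hLt : (t - s) * L < d / 2 := by
      have h1 : t - s < d / (2 * (L + 1)) := by linarith [ht.2]
      have h2 : (t - s) * (2 * (L + 1)) < d := (lt_div_iff₀ (by positivity)).1 h1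
      nlinarith [sub_nonneg.2 hst]
    have hev1 := ((hgap hs hst).mul_const L).eventually_lt_const hLt
    have hev2 := Metric.tendsto_nhds.1 (hx s) (d / 2) (by positivity)
    have hlimL : Tendsto (fun n => ‖X n t - X n s - (((N n t : ℝ) - N n s) * h n) • F (x s)‖) U
        (𝓝 ‖x t - x s - (t - s) • F (x s)‖) :=
      (((hx t).sub (hx s)).sub ((hgap hs hst).smul_const _)).norm
    have hlimR := (hgap hs hst).mul_const e
    rw [mul_comm]
    refine le_of_tendsto_of_tendsto hlimL hlimR ?_
    filter_upwards [hev1, hev2] with n hn1 hn2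
    refine norm_eulerNode_sub_le (hh n) (hmono n hst) fun j hj hjm => ?_
    rw [← dist_eq_norm]
    refine (hdF _ ?_).le
    have h4 : ‖eulerNode F x₀ (h n) j - X n s‖ ≤ ((j : ℝ) - N n s) * h n * L := by
      simpa using norm_eulerNode_sub_le (F := F) (x₀ := x₀) (hh n) (w := 0) hj
        fun i _ _ => by simpa using hL (eulerNode F x₀ (h n) i)
    have h5 : ((j : ℝ) - N n s) * h n * L ≤ ((N n t : ℝ) - N n s) * h n * L := by
      have : (j : ℝ) ≤ N n t := by exact_mod_cast hjm.le
      have := hh n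
      gcongr
    rw [← dist_eq_norm] at h4
    linarith [dist_triangle (eulerNode F x₀ (h n) j) (X n s) (x s)]

end Peano

/-! ### The Lyapunov function -/

section Lyapunov

lemma hasFDerivAt_V (Ξ : State) :
    HasFDerivAt V ((2 * Ξ.1) • ContinuousLinearMap.fst ℝ ℝ (ℝ × ℝ)
      + (2 * Ξ.2.1) • (ContinuousLinearMap.fst ℝ ℝ ℝ).comp (ContinuousLinearMap.snd ℝ ℝ (ℝ × ℝ))
      + (2 * (Ξ.2.2 + 1 / 2 * Real.arctan (2 * Ξ.2.1))) •
        ((ContinuousLinearMap.snd ℝ ℝ ℝ).comp (ContinuousLinearMap.snd ℝ ℝ (ℝ × ℝ))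
          + (1 / (1 + (2 * Ξ.2.1) ^ 2)) •
            (ContinuousLinearMap.fst ℝ ℝ ℝ).comp (ContinuousLinearMap.snd ℝ ℝ (ℝ × ℝ)))) Ξ := by
  have h1 : HasFDerivAt (fun Ξ : State => Ξ.1) (ContinuousLinearMap.fst ℝ ℝ (ℝ × ℝ)) Ξ :=
    hasFDerivAt_fst
  have hs : HasFDerivAt (fun Ξ : State => Ξ.2) (ContinuousLinearMap.snd ℝ ℝ (ℝ × ℝ)) Ξ :=
    hasFDerivAt_snd
  have h2 : HasFDerivAt (fun Ξ : State => Ξ.2.1) _ Ξ :=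
    (hasFDerivAt_fst (𝕜 := ℝ) (p := Ξ.2)).comp Ξ hs
  have h3 : HasFDerivAt (fun Ξ : State => Ξ.2.2) _ Ξ :=
    (hasFDerivAt_snd (𝕜 := ℝ) (p := Ξ.2)).comp Ξ hs
  have h4 := (h2.const_mul 2).arctan
  have := ((h1.pow 2).add (h2.pow 2)).add ((h3.add (h4.const_mul (1 / 2))).pow 2)
  convert! this using 1
  ext <;> simp <;> ring

lemma fderiv_V_apply (Ξ w : State) :
    fderiv ℝ V Ξ w = 2 * Ξ.1 * w.1 + 2 * Ξ.2.1 * w.2.1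
      + 2 * (Ξ.2.2 + 1 / 2 * Real.arctan (2 * Ξ.2.1)) * (w.2.2 + 1 / (1 + (2 * Ξ.2.1) ^ 2) * w.2.1) := by
  rw [(hasFDerivAt_V Ξ).fderiv]
  simp [mul_add]

lemma ν₁_eq (Ξ : State) :
    ν₁ Ξ = -2 * Ξ.1 ^ 2 * Real.cos Ξ.2.2 + 2 * Ξ.2.1 * Real.sin Ξ.2.2
      + 2 * (Ξ.2.2 + 1 / 2 * Real.arctan (2 * Ξ.2.1)) *
        (1 + 1 / (1 + (2 * Ξ.2.1) ^ 2)) * Real.sin Ξ.2.2 := by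
  rw [ν₁, lieDeriv, fderiv_V_apply]
  simp only [gbar₁]
  ring

lemma ν₂_eq (Ξ : State) : ν₂ Ξ = -2 * (Ξ.2.2 + 1 / 2 * Real.arctan (2 * Ξ.2.1)) := by
  rw [ν₂, lieDeriv, fderiv_V_apply]
  simp only [g₂]
  ring

lemma fderiv_V_rhs (Ξ : State) (v ω : ℝ) :
    fderiv ℝ V Ξ (rhs Ξ v ω) = ν₁ Ξ * (v / Ξ.1) + ν₂ Ξ * ω := by
  rw [rhs, map_add, map_smul, map_smul, ν₁, ν₂, lieDeriv, lieDeriv, smul_eq_mul, smul_eq_mul]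
  ring

lemma continuous_V : Continuous V := by unfold V; fun_prop

lemma continuous_ν₁ : Continuous ν₁ := by
  rw [funext ν₁_eq]
  have : ∀ Ξ : State, 1 + (2 * Ξ.2.1) ^ 2 ≠ 0 := fun Ξ => by positivity
  fun_prop (disch := assumption)

lemma continuous_ν₂ : Continuous ν₂ := by
  rw [funext ν₂_eq]
  fun_prop

lemma V_nonneg (Ξ : State) : 0 ≤ V Ξ := by unfold V; positivity

lemma V_zero : V 0 = 0 := by simp [V]

lemma lipschitzWith_arctan : LipschitzWith 1 Real.arctan := by
  refine lipschitzWith_of_nnnorm_deriv_le Real.differentiable_arctan fun y => ?_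
  rw [← NNReal.coe_le_coe, coe_nnnorm, Real.deriv_arctan, Real.norm_of_nonneg (by positivity)]
  exact div_le_one_of_le₀ (by nlinarith [sq_nonneg y]) (by positivity)

lemma abs_arctan_le (x : ℝ) : |Real.arctan x| ≤ |x| := by
  simpa using lipschitzWith_arctan.dist_le_mul x 0

/-- The factor `2` comes from `γ = z - arctan(2δ)/2` with `|arctan(2δ)| ≤ 2|δ|`, where `|z|` and
`|δ|` are each at most `√V`. -/
lemma norm_le_two_mul_sqrt_V (Ξ : State) : ‖Ξ‖ ≤ 2 * √(V Ξ) := by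
  set z := Ξ.2.2 + 1 / 2 * Real.arctan (2 * Ξ.2.1) with hz
  have hV : V Ξ = Ξ.1 ^ 2 + Ξ.2.1 ^ 2 + z ^ 2 := rfl
  have h1 : |Ξ.1| ≤ √(V Ξ) := Real.abs_le_sqrt (by rw [hV]; nlinarith [sq_nonneg Ξ.2.1, sq_nonneg z])
  have h2 : |Ξ.2.1| ≤ √(V Ξ) := Real.abs_le_sqrt (by rw [hV]; nlinarith [sq_nonneg Ξ.1, sq_nonneg z])
  have h3 : |z| ≤ √(V Ξ) :=
    Real.abs_le_sqrt (by rw [hV]; nlinarith [sq_nonneg Ξ.1, sq_nonneg Ξ.2.1])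
  have h4 : |Real.arctan (2 * Ξ.2.1)| ≤ 2 * |Ξ.2.1| := by
    simpa [abs_mul] using abs_arctan_le (2 * Ξ.2.1)
  have h5 : |Ξ.2.2| ≤ 2 * √(V Ξ) := by
    have : Ξ.2.2 = z - 1 / 2 * Real.arctan (2 * Ξ.2.1) := by rw [hz]; ring
    obtain ⟨h3l, h3u⟩ := abs_le.1 h3
    obtain ⟨h4l, h4u⟩ := abs_le.1 h4
    exact abs_le.2 ⟨by linarith, by linarith⟩
  have h0 := Real.sqrt_nonneg (V Ξ)
  rw [Prod.norm_def, Prod.norm_def]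
  simp only [Real.norm_eq_abs, sup_le_iff]
  exact ⟨by linarith, by linarith, h5⟩

lemma isClosed_closedStateSpace : IsClosed closedStateSpace :=
  isClosed_Ici.preimage continuous_fst

lemma stateSpace_subset : stateSpace ⊆ closedStateSpace := fun _ h =>
  le_of_lt (show (0 : ℝ) < _ from h)

/-- Bounds must be uniform up to `ρ = 0`, which trajectories may approach; hence the closed
half-space, where the weights are still continuous and positive. -/
lemma isCompact_V_mem {s : Set ℝ} (hs : IsClosed s) {M : ℝ} (hM : ∀ r ∈ s, r ≤ M) :
    IsCompact (closedStateSpace ∩ V ⁻¹' s) := by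
  refine Metric.isCompact_of_isClosed_isBounded
    (isClosed_closedStateSpace.inter (hs.preimage continuous_V)) ?_
  refine (Metric.isBounded_closedBall (x := (0 : State)) (r := 2 * √M)).subset fun Ξ hΞ => ?_
  rw [mem_closedBall_zero_iff]
  exact (norm_le_two_mul_sqrt_V Ξ).trans
    (mul_le_mul_of_nonneg_left (Real.sqrt_le_sqrt (hM _ hΞ.2)) two_pos.le)

/-- `ν₂ = 0` forces `γ = -arctan(2δ)/2`, so `|γ| < π/4`. Then `cos γ > 0`, and `sin γ` has the sign
opposite to `δ`. What remains of `ν₁` is `-2ρ² cos γ + 2δ sin γ`, a sum of two nonpositive terms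
that must both vanish. -/
lemma eq_zero_of_ν_eq_zero {Ξ : State} (h1 : ν₁ Ξ = 0) (h2 : ν₂ Ξ = 0) :
    Ξ = 0 := by
  rw [ν₂_eq] at h2
  have hz : Ξ.2.2 + 1 / 2 * Real.arctan (2 * Ξ.2.1) = 0 := by linarith
  rw [ν₁_eq, hz] at h1
  have hγ : Ξ.2.2 = -(1 / 2 * Real.arctan (2 * Ξ.2.1)) := by linarith
  have hl := Real.neg_pi_div_two_lt_arctan (2 * Ξ.2.1)
  have hu := Real.arctan_lt_pi_div_two (2 * Ξ.2.1)
  have hpi := Real.pi_pos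
  have hcos : 0 < Real.cos Ξ.2.2 := Real.cos_pos_of_mem_Ioo ⟨by linarith, by linarith⟩
  have hsin : Ξ.2.1 ≠ 0 → Ξ.2.1 * Real.sin Ξ.2.2 < 0 := fun hne => by
    rcases lt_or_gt_of_ne hne with h | h
    · refine mul_neg_of_neg_of_pos h (Real.sin_pos_of_pos_of_lt_pi ?_ (by linarith))
      have : Real.arctan (2 * Ξ.2.1) < 0 := Real.arctan_lt_zero.2 (by linarith)
      linarith
    · refine mul_neg_of_pos_of_neg h (Real.sin_neg_of_neg_of_neg_pi_lt ?_ (by linarith))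
      have : 0 < Real.arctan (2 * Ξ.2.1) := Real.arctan_pos.2 (by linarith)
      linarith
  have hδ : Ξ.2.1 = 0 := by
    by_contra hne
    nlinarith [hsin hne, mul_nonneg (sq_nonneg Ξ.1) hcos.le]
  have hγ0 : Ξ.2.2 = 0 := by simpa [hδ] using hγ
  have hρ : Ξ.1 = 0 := by simpa [hδ, hγ0] using h1
  exact Prod.ext hρ (Prod.ext hδ hγ0)

lemma ν₁_zero : ν₁ 0 = 0 := by simp [ν₁_eq]

lemma ν₂_zero : ν₂ 0 = 0 := by simp [ν₂_eq]

end Lyapunov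

/-! ### Trajectories -/

section Trajectories

lemma _root_.LipschitzWith.comp_absolutelyContinuousOnInterval {X Y : Type*} [PseudoMetricSpace X]
    [PseudoMetricSpace Y] {K : NNReal} {g : X → Y} (hg : LipschitzWith K g) {f : ℝ → X} {a b : ℝ}
    (hf : AbsolutelyContinuousOnInterval f a b) :
    AbsolutelyContinuousOnInterval (g ∘ f) a b := by
  rw [absolutelyContinuousOnInterval_iff] at hf ⊢
  intro e he
  obtain ⟨d, hd, h⟩ := hf (e / (K + 1)) (by positivity)
  refine ⟨d, hd, fun I hI hId => ?_⟩
  have h1 := h I hI hId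
  rw [lt_div_iff₀ (by positivity)] at h1
  refine lt_of_le_of_lt ?_ h1
  rw [Finset.sum_mul]
  refine Finset.sum_le_sum fun i _ => ?_
  refine (hg.dist_le_mul _ _).trans ?_
  rw [mul_comm]
  exact mul_le_mul_of_nonneg_left (by linarith) dist_nonneg

/-- A nondegenerate interval in `[0, ∞)` that contains `0` and has no largest element. -/
structure IsTimeInterval (J : Set ℝ) : Prop where
  subset : J ⊆ Ici 0
  zero_mem : (0 : ℝ) ∈ J
  ordConnected : J.OrdConnected
  exists_gt : ∀ t ∈ J, ∃ u ∈ J, t < u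

lemma isTimeInterval_Ici : IsTimeInterval (Ici 0) where
  subset := subset_rfl
  zero_mem := mem_Ici.2 le_rfl
  ordConnected := ordConnected_Ici
  exists_gt t ht := ⟨t + 1, mem_Ici.2 (by linarith [mem_Ici.1 ht]), by linarith⟩

lemma isTimeInterval_Ico {T : ℝ} (hT : 0 < T) : IsTimeInterval (Ico 0 T) where
  subset := Ico_subset_Ici_self
  zero_mem := ⟨le_rfl, hT⟩
  ordConnected := ordConnected_Ico
  exists_gt t ht := ⟨(t + T) / 2, ⟨by linarith [ht.1, ht.2], by linarith [ht.2]⟩,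
    by linarith [ht.2]⟩

namespace IsTimeInterval

variable {J : Set ℝ}

lemma Icc_subset (hJ : IsTimeInterval J) {t : ℝ} (ht : t ∈ J) : Icc 0 t ⊆ J :=
  hJ.ordConnected.out hJ.zero_mem ht

lemma Icc_mem_nhdsWithin (hJ : IsTimeInterval J) {t u : ℝ} (htu : t < u) : Icc 0 u ∈ 𝓝[J] t := by
  filter_upwards [self_mem_nhdsWithin, mem_nhdsWithin_of_mem_nhds (Iio_mem_nhds htu)] with s hs hsu
  exact ⟨hJ.subset hs, le_of_lt hsu⟩

lemma mem_nhdsGE (hJ : IsTimeInterval J) {t : ℝ} (ht : t ∈ J) : J ∈ 𝓝[≥] t := by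
  obtain ⟨u, hu, htu⟩ := hJ.exists_gt t ht
  exact mem_of_superset (Icc_mem_nhdsGE htu) (hJ.ordConnected.out ht hu)

end IsTimeInterval

variable {J : Set ℝ} {v ω : ℝ → ℝ} {Ξ : ℝ → State}

/-- The Lyapunov function is absolutely continuous along a trajectory, and its increments are the
integrals of its derivative `ν₁ v / ρ + ν₂ ω`. -/
lemma IsTrajectoryOn.integral_eq_V_sub (h : IsTrajectoryOn J v ω Ξ) (hJ : IsTimeInterval J) {t : ℝ}
    (ht : t ∈ J) :
    IntervalIntegrable (fun s => ν₁ (Ξ s) * (v s / (Ξ s).1) + ν₂ (Ξ s) * ω s) volume 0 t ∧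
      ∫ s in (0 : ℝ)..t, (ν₁ (Ξ s) * (v s / (Ξ s).1) + ν₂ (Ξ s) * ω s) = V (Ξ t) - V (Ξ 0) := by
  have ht0 : 0 ≤ t := hJ.subset ht
  set f : ℝ → State := fun s => rhs (Ξ s) (v s) (ω s)
  -- `Ξ` is unconstrained outside `J`; the theorems on primitives apply to `I`, which agrees with
  -- `Ξ` on `[0, t]`.
  set I : ℝ → State := fun x => Ξ 0 + ∫ s in (0 : ℝ)..x, f s with hI
  have hf : IntervalIntegrable f volume 0 t := h.integrable t ht
  have hIΞ : ∀ s ∈ uIcc 0 t, Ξ s = I s := fun s hs => by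
    rw [uIcc_of_le ht0] at hs
    exact h.eq_integral s (hJ.Icc_subset ht hs)
  have hac : ∀ L : State →L[ℝ] ℝ, AbsolutelyContinuousOnInterval (fun x => L (I x)) 0 t := by
    intro L
    have hLf : IntervalIntegrable (fun s => L (f s)) volume 0 t :=
      ⟨L.integrable_comp hf.1, L.integrable_comp hf.2⟩
    have h1 := hLf.absolutelyContinuousOnInterval_intervalIntegral (c := 0) left_mem_uIcc
    have h2 : AbsolutelyContinuousOnInterval (fun _ : ℝ => L (Ξ 0)) 0 t :=
      ((LipschitzWith.const (L (Ξ 0))).lipschitzOnWith (s := uIcc 0 t)).absolutelyContinuousOnInterval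
    have h3 := h2.add h1
    refine (absolutelyContinuousOnInterval_iff _ _ _).2 fun e he => ?_
    obtain ⟨d, hd, h4⟩ := (absolutelyContinuousOnInterval_iff _ _ _).1 h3 e he
    refine ⟨d, hd, fun A hA hAd => ?_⟩
    refine lt_of_eq_of_lt (Finset.sum_congr rfl fun i hi => ?_) (h4 A hA hAd)
    have key : ∀ x ∈ uIcc 0 t, L (I x) = L (Ξ 0) + ∫ s in (0 : ℝ)..x, L (f s) := fun x hx => by
      rw [hI, map_add, L.intervalIntegral_comp_comm
        (hf.mono_set (uIcc_subset_uIcc left_mem_uIcc hx))]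
    rw [key _ (hA.1 i hi).1, key _ (hA.1 i hi).2]
    rfl
  have h1 := hac (ContinuousLinearMap.fst ℝ ℝ (ℝ × ℝ))
  have h2 := hac ((ContinuousLinearMap.fst ℝ ℝ ℝ).comp (ContinuousLinearMap.snd ℝ ℝ (ℝ × ℝ)))
  have h3 := hac ((ContinuousLinearMap.snd ℝ ℝ ℝ).comp (ContinuousLinearMap.snd ℝ ℝ (ℝ × ℝ)))
  -- `V` is built from the coordinates by sums, products and the Lipschitz function `arctan`, all of
  -- which preserve absolute continuity.
  have h4 := (lipschitzWith_arctan.comp_absolutelyContinuousOnInterval (h2.const_mul 2)).const_mul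
    (1 / 2)
  have h5 := h3.add h4
  have hV : AbsolutelyContinuousOnInterval (fun x => V (I x)) 0 t := by
    have h6 := ((h1.mul h1).add (h2.mul h2)).add (h5.mul h5)
    convert! h6 using 1
    funext x
    simp [V, sq]
  have hder : ∀ᵐ s, s ∈ uIcc 0 t →
      deriv (fun x => V (I x)) s = ν₁ (Ξ s) * (v s / (Ξ s).1) + ν₂ (Ξ s) * ω s := by
    filter_upwards [hf.ae_hasDerivAt_integral] with s hs hst
    have hd : HasDerivAt I (f s) s := (hs hst 0 left_mem_uIcc).const_add (Ξ 0)
    have hd' := ((hasFDerivAt_V (I s)).differentiableAt.hasFDerivAt).comp_hasDerivAt s hd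
    have hd'' : HasDerivAt (fun x => V (I x)) (fderiv ℝ V (I s) (f s)) s := hd'
    rw [hd''.deriv, ← hIΞ s hst, fderiv_V_rhs]
  have hder' : ∀ᵐ s, s ∈ uIoc 0 t →
      deriv (fun x => V (I x)) s = ν₁ (Ξ s) * (v s / (Ξ s).1) + ν₂ (Ξ s) * ω s := by
    filter_upwards [hder] with s hs hst using hs (uIoc_subset_uIcc hst)
  constructor
  · exact hV.intervalIntegrable_deriv.congr_ae ((ae_restrict_iff' measurableSet_uIoc).2 hder')
  · rw [← intervalIntegral.integral_congr_ae hder', hV.integral_deriv_eq_sub,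
      ← hIΞ t right_mem_uIcc, ← hIΞ 0 left_mem_uIcc]

variable {k₁ k₂ : State → ℝ}

/-- Closed-loop trajectories of a continuous feedback are the solutions of the differential equation
in the sense of right derivatives. -/
lemma isClosedLoopOn_iff (hJ : IsTimeInterval J)
    (hk : ContinuousOn (fun Ξ => rhs Ξ (k₁ Ξ) (k₂ Ξ)) stateSpace) :
    IsClosedLoopOn J k₁ k₂ Ξ ↔ MapsTo Ξ J stateSpace ∧ ContinuousOn Ξ J ∧
      ∀ t ∈ J, HasDerivWithinAt Ξ (rhs (Ξ t) (k₁ (Ξ t)) (k₂ (Ξ t))) (Ici t) t := by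
  constructor
  · intro h
    have hcont : ContinuousOn Ξ J := fun t ht => by
      obtain ⟨u, hu, htu⟩ := hJ.exists_gt t ht
      have hu0 : 0 ≤ u := hJ.subset hu
      have h1 : ContinuousOn (fun x => Ξ 0 + ∫ s in (0 : ℝ)..x, rhs (Ξ s) (k₁ (Ξ s)) (k₂ (Ξ s)))
          (uIcc 0 u) :=
        continuousOn_const.add
          (intervalIntegral.continuousOn_primitive_interval' (h.integrable u hu) left_mem_uIcc)
      rw [uIcc_of_le hu0] at h1
      have h2 : ContinuousOn Ξ (Icc 0 u) :=
        h1.congr fun s hs => h.eq_integral s (hJ.Icc_subset hu hs)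
      exact (h2 t ⟨hJ.subset ht, htu.le⟩).mono_of_mem_nhdsWithin (hJ.Icc_mem_nhdsWithin htu)
    refine ⟨h.mem, hcont, fun t ht => ?_⟩
    have hc : ContinuousOn (fun s => rhs (Ξ s) (k₁ (Ξ s)) (k₂ (Ξ s))) J := hk.comp hcont h.mem
    obtain ⟨u, hu, htu⟩ := hJ.exists_gt t ht
    have hsub : Ioo t u ⊆ J := Ioo_subset_Icc_self.trans (hJ.ordConnected.out ht hu)
    have hmeas : StronglyMeasurableAtFilter (fun s => rhs (Ξ s) (k₁ (Ξ s)) (k₂ (Ξ s))) (𝓝[>] t) :=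
      ⟨Ioo t u, Ioo_mem_nhdsGT htu, (hc.mono hsub).aestronglyMeasurable measurableSet_Ioo⟩
    have hct : ContinuousWithinAt (fun s => rhs (Ξ s) (k₁ (Ξ s)) (k₂ (Ξ s))) (Ioi t) t :=
      (hc t ht).mono_of_mem_nhdsWithin
        (nhdsWithin_mono t Ioi_subset_Ici_self (hJ.mem_nhdsGE ht))
    have hd := (intervalIntegral.integral_hasDerivWithinAt_right (s := Ici t) (t := Ioi t)
      (h.integrable t ht) hmeas hct).const_add (Ξ 0)
    refine hd.congr_of_eventuallyEq ?_ (h.eq_integral t ht)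
    filter_upwards [hJ.mem_nhdsGE ht] with s hs using h.eq_integral s hs
  · rintro ⟨hmem, hcont, hder⟩
    have hc : ContinuousOn (fun s => rhs (Ξ s) (k₁ (Ξ s)) (k₂ (Ξ s))) J := hk.comp hcont hmem
    have hint : ∀ t ∈ J, IntervalIntegrable (fun s => rhs (Ξ s) (k₁ (Ξ s)) (k₂ (Ξ s))) volume 0 t :=
      fun t ht => by
        refine ContinuousOn.intervalIntegrable (hc.mono ?_)
        rw [uIcc_of_le (hJ.subset ht)]
        exact hJ.Icc_subset ht
    refine ⟨hmem, hint, fun t ht => ?_⟩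
    rw [intervalIntegral.integral_eq_sub_of_hasDeriv_right_of_le (hJ.subset ht)
      (hcont.mono (hJ.Icc_subset ht)) (fun s hs => (hder s (hJ.Icc_subset ht
        (Ioo_subset_Icc_self hs))).mono Ioi_subset_Ici_self) (hint t ht)]
    abel

end Trajectories

/-! ### Forward completeness -/

section Completeness

/-- The state with `log ρ` in place of `ρ`; this makes the state space all of `ℝ³`. -/
noncomputable def toLog (Ξ : State) : State := (Real.log Ξ.1, Ξ.2)

/-- The inverse of `toLog`. -/
noncomputable def ofLog (y : State) : State := (Real.exp y.1, y.2)

/-- The closed-loop vector field for `v = ρ c₁`, `ω = c₂`, in the coordinates `(log ρ, δ, γ)`. -/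
noncomputable def logField (c₁ c₂ : State → ℝ) (Ξ : State) : State :=
  (-Real.cos Ξ.2.2 * c₁ Ξ, Real.sin Ξ.2.2 * c₁ Ξ, Real.sin Ξ.2.2 * c₁ Ξ - c₂ Ξ)

lemma ofLog_mem (y : State) : ofLog y ∈ stateSpace := Real.exp_pos _

lemma ofLog_toLog {Ξ : State} (h : Ξ ∈ stateSpace) : ofLog (toLog Ξ) = Ξ :=
  Prod.ext (Real.exp_log h) rfl

lemma continuous_ofLog : Continuous ofLog := by unfold ofLog; fun_prop

lemma continuousOn_toLog : ContinuousOn toLog stateSpace :=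
  (continuousOn_fst.log fun _ h => ne_of_gt h).prodMk continuousOn_snd

lemma rhs_mul (Ξ : State) (hΞ : Ξ ∈ stateSpace) (a b : ℝ) :
    rhs Ξ (Ξ.1 * a) b =
      (Ξ.1 * (-Real.cos Ξ.2.2 * a), Real.sin Ξ.2.2 * a, Real.sin Ξ.2.2 * a - b) := by
  have h : Ξ.1 ≠ 0 := ne_of_gt hΞ
  rw [rhs, mul_div_cancel_left₀ a h]
  refine Prod.ext ?_ (Prod.ext ?_ ?_)
  all_goals simp only [gbar₁, g₂, Prod.fst_add, Prod.snd_add, Prod.smul_fst, Prod.smul_snd,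
    smul_eq_mul]; ring

lemma hasDerivWithinAt_ofLog {x : ℝ → State} {w : State} {s : Set ℝ} {t : ℝ}
    (h : HasDerivWithinAt x w s t) :
    HasDerivWithinAt (fun t => ofLog (x t)) ((ofLog (x t)).1 * w.1, w.2) s t :=
  ((hasFDerivAt_fst.comp_hasDerivWithinAt t h).exp).prodMk
    (hasFDerivAt_snd.comp_hasDerivWithinAt t h)

lemma hasDerivWithinAt_toLog {x : ℝ → State} {w : State} {s : Set ℝ} {t : ℝ}
    (h : HasDerivWithinAt x w s t) (hx : x t ∈ stateSpace) :
    HasDerivWithinAt (fun t => toLog (x t)) (w.1 / (x t).1, w.2) s t :=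
  ((hasFDerivAt_fst.comp_hasDerivWithinAt t h).log (ne_of_gt hx)).prodMk
    (hasFDerivAt_snd.comp_hasDerivWithinAt t h)

variable {c₁ c₂ : State → ℝ}

lemma continuousOn_logField {s : Set State} (hc₁ : ContinuousOn c₁ s) (hc₂ : ContinuousOn c₂ s) :
    ContinuousOn (logField c₁ c₂) s := by
  unfold logField
  fun_prop

lemma continuousOn_rhs {s : Set State} (hs : s ⊆ stateSpace) (hc₁ : ContinuousOn c₁ s)
    (hc₂ : ContinuousOn c₂ s) : ContinuousOn (fun Ξ => rhs Ξ (Ξ.1 * c₁ Ξ) (c₂ Ξ)) s := by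
  refine ContinuousOn.congr (f := fun Ξ : State =>
    (Ξ.1 * (-Real.cos Ξ.2.2 * c₁ Ξ), Real.sin Ξ.2.2 * c₁ Ξ, Real.sin Ξ.2.2 * c₁ Ξ - c₂ Ξ)) ?_
    fun Ξ hΞ => rhs_mul Ξ (hs hΞ) _ _
  fun_prop

lemma V_le_of_isClosedLoopOn {J : Set ℝ} (hJ : IsTimeInterval J)
    (hneg : ∀ Ξ ∈ stateSpace, ν₁ Ξ * c₁ Ξ + ν₂ Ξ * c₂ Ξ ≤ 0) {Ξ : ℝ → State}
    (h : IsClosedLoopOn J (fun Ξ => Ξ.1 * c₁ Ξ) c₂ Ξ) {s t : ℝ} (hs : s ∈ J) (ht : t ∈ J)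
    (hst : s ≤ t) : V (Ξ t) ≤ V (Ξ s) := by
  have h2 : ∀ u ∈ Icc s t,
      ν₁ (Ξ u) * ((Ξ u).1 * c₁ (Ξ u) / (Ξ u).1) + ν₂ (Ξ u) * c₂ (Ξ u) ≤ 0 := fun u hu => by
    have hm := h.mem u (hJ.ordConnected.out hs ht hu)
    rw [mul_div_cancel_left₀ _ (ne_of_gt hm)]
    exact hneg _ hm
  obtain ⟨hi, he⟩ := IsTrajectoryOn.integral_eq_V_sub h hJ ht
  obtain ⟨hi', he'⟩ := IsTrajectoryOn.integral_eq_V_sub h hJ hs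
  have h3 := intervalIntegral.integral_mono_on hst (hi'.symm.trans hi) intervalIntegrable_const h2
  rw [intervalIntegral.integral_zero, ← intervalIntegral.integral_interval_sub_left hi hi', he,
    he'] at h3
  linarith

/-- Although `log ρ` is singular at `ρ = 0`, the field in that coordinate is a function of the state
that is continuous there, so compactness of the sublevel set applies. -/
lemma exists_norm_logField_le (hc₁ : ContinuousOn c₁ closedStateSpace)
    (hc₂ : ContinuousOn c₂ closedStateSpace) (M : ℝ) :
    ∃ C, 0 ≤ C ∧ ∀ Ξ ∈ closedStateSpace, V Ξ ≤ M → ‖logField c₁ c₂ Ξ‖ ≤ C := by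
  obtain ⟨C, hC⟩ := (isCompact_V_mem (isClosed_Iic (a := M)) fun _ h => h).exists_bound_of_continuousOn
    ((continuousOn_logField hc₁ hc₂).mono inter_subset_left)
  exact ⟨max C 0, le_max_right _ _, fun Ξ h1 h2 => (hC Ξ ⟨h1, h2⟩).trans (le_max_left _ _)⟩

/-- Multiplying the field by a cutoff of `V` makes it bounded, so Peano's theorem gives a global
solution. The cutoff only rescales `dV/dt`, so `V` still does not increase, and the solution never
leaves the region where the cutoff is `1`. -/
lemma exists_isClosedLoopOn_Ici (hc₁ : ContinuousOn c₁ closedStateSpace)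
    (hc₂ : ContinuousOn c₂ closedStateSpace)
    (hneg : ∀ Ξ ∈ stateSpace, ν₁ Ξ * c₁ Ξ + ν₂ Ξ * c₂ Ξ ≤ 0) {Ξ₀ : State} (hΞ₀ : Ξ₀ ∈ stateSpace) :
    ∃ Ξ : ℝ → State, Ξ 0 = Ξ₀ ∧ IsClosedLoopOn (Ici 0) (fun Ξ => Ξ.1 * c₁ Ξ) c₂ Ξ := by
  have hd₁ := hc₁.mono stateSpace_subset
  have hd₂ := hc₂.mono stateSpace_subset
  obtain ⟨C, hC0, hC⟩ := exists_norm_logField_le hc₁ hc₂ (V Ξ₀ + 1)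
  -- Equal to `1` where `V ≤ V Ξ₀` and to `0` where `V ≥ V Ξ₀ + 1`.
  let χ : State → ℝ := fun Ξ => max 0 (min 1 (V Ξ₀ + 1 - V Ξ))
  have hχ : Continuous χ :=
    continuous_const.max (continuous_const.min (continuous_const.sub continuous_V))
  have hχ0 : ∀ Ξ, 0 ≤ χ Ξ := fun Ξ => le_max_left _ _
  have hχ1 : ∀ Ξ, χ Ξ ≤ 1 := fun Ξ => max_le zero_le_one (min_le_left _ _)
  have hF : Continuous fun y => χ (ofLog y) • logField c₁ c₂ (ofLog y) :=
    (hχ.comp continuous_ofLog).smul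
      ((continuousOn_logField hd₁ hd₂).comp_continuous continuous_ofLog ofLog_mem)
  have hFC : ∀ y, ‖χ (ofLog y) • logField c₁ c₂ (ofLog y)‖ ≤ C := fun y => by
    rw [norm_smul, Real.norm_of_nonneg (hχ0 _)]
    rcases le_total (V (ofLog y)) (V Ξ₀ + 1) with h | h
    · exact (mul_le_of_le_one_left (norm_nonneg _) (hχ1 _)).trans
        (hC _ (stateSpace_subset (ofLog_mem y)) h)
    · have : χ (ofLog y) = 0 := max_eq_left ((min_le_right _ _).trans (sub_nonpos.2 h))
      rw [this, zero_mul]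
      exact hC0
  obtain ⟨x, hx0, hxc, hxd⟩ := exists_hasDerivWithinAt_of_bounded hF hFC (toLog Ξ₀)
  have hmem : MapsTo (fun t => ofLog (x t)) (Ici 0) stateSpace := fun t _ => ofLog_mem _
  have hcont : ContinuousOn (fun t => ofLog (x t)) (Ici 0) := continuous_ofLog.comp_continuousOn hxc
  have h0 : ofLog (x 0) = Ξ₀ := by rw [hx0, ofLog_toLog hΞ₀]
  have hder : ∀ t ∈ Ici (0 : ℝ), HasDerivWithinAt (fun t => ofLog (x t))
      (rhs (ofLog (x t)) ((ofLog (x t)).1 * (χ (ofLog (x t)) * c₁ (ofLog (x t))))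
        (χ (ofLog (x t)) * c₂ (ofLog (x t)))) (Ici t) t := fun t ht => by
    refine (hasDerivWithinAt_ofLog (hxd t ht)).congr_deriv ?_
    rw [rhs_mul _ (ofLog_mem _)]
    refine Prod.ext ?_ (Prod.ext ?_ ?_)
    all_goals simp only [logField, Prod.smul_fst, Prod.smul_snd, smul_eq_mul]; ring
  have htrunc : IsClosedLoopOn (Ici 0) (fun Ξ => Ξ.1 * (χ Ξ * c₁ Ξ)) (fun Ξ => χ Ξ * c₂ Ξ)
      (fun t => ofLog (x t)) :=
    (isClosedLoopOn_iff isTimeInterval_Ici (continuousOn_rhs subset_rfl (hχ.continuousOn.mul hd₁)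
      (hχ.continuousOn.mul hd₂))).2 ⟨hmem, hcont, hder⟩
  have hV : ∀ t ∈ Ici (0 : ℝ), V (ofLog (x t)) ≤ V Ξ₀ := fun t ht => by
    have := V_le_of_isClosedLoopOn isTimeInterval_Ici (fun Ξ hΞ => by
      have := mul_nonpos_of_nonneg_of_nonpos (hχ0 Ξ) (hneg Ξ hΞ)
      linarith) htrunc (mem_Ici.2 le_rfl) ht ht
    simpa only [h0] using this
  refine ⟨fun t => ofLog (x t), h0, (isClosedLoopOn_iff isTimeInterval_Ici
    (continuousOn_rhs subset_rfl hd₁ hd₂)).2 ⟨hmem, hcont, fun t ht => ?_⟩⟩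
  have hχt : χ (ofLog (x t)) = 1 := by
    have : min 1 (V Ξ₀ + 1 - V (ofLog (x t))) = 1 := min_eq_left (by linarith [hV t ht])
    simp only [χ, this]
    exact max_eq_right zero_le_one
  have := hder t ht
  rwa [hχt, one_mul, one_mul] at this

/-- A closed-loop trajectory on a bounded time interval has a limit in the state space. -/
lemma exists_tendsto_of_isClosedLoopOn (hc₁ : ContinuousOn c₁ closedStateSpace)
    (hc₂ : ContinuousOn c₂ closedStateSpace)
    (hneg : ∀ Ξ ∈ stateSpace, ν₁ Ξ * c₁ Ξ + ν₂ Ξ * c₂ Ξ ≤ 0) {T : ℝ} (hT : 0 < T) {Ξ : ℝ → State}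
    (h : IsClosedLoopOn (Ico 0 T) (fun Ξ => Ξ.1 * c₁ Ξ) c₂ Ξ) :
    ∃ Ξ₁ ∈ stateSpace, Tendsto Ξ (𝓝[<] T) (𝓝 Ξ₁) := by
  have hJ := isTimeInterval_Ico hT
  obtain ⟨hmem, hcont, hder⟩ := (isClosedLoopOn_iff hJ (continuousOn_rhs subset_rfl
    (hc₁.mono stateSpace_subset) (hc₂.mono stateSpace_subset))).1 h
  obtain ⟨C, hC0, hC⟩ := exists_norm_logField_le hc₁ hc₂ (V (Ξ 0))
  have hcont' : ContinuousOn (fun t => toLog (Ξ t)) (Ico 0 T) := continuousOn_toLog.comp hcont hmem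
  have hder' : ∀ t ∈ Ico 0 T,
      HasDerivWithinAt (fun t => toLog (Ξ t)) (logField c₁ c₂ (Ξ t)) (Ici t) t := fun t ht => by
    refine (hasDerivWithinAt_toLog (hder t ht) (hmem ht)).congr_deriv ?_
    rw [rhs_mul _ (hmem ht), mul_div_cancel_left₀ _ (ne_of_gt (hmem ht))]
    rfl
  have hbound : ∀ t ∈ Ico 0 T, ‖logField c₁ c₂ (Ξ t)‖ ≤ C := fun t ht =>
    hC _ (stateSpace_subset (hmem ht)) (V_le_of_isClosedLoopOn hJ hneg h hJ.zero_mem ht ht.1)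
  have hle : ∀ s ∈ Ico 0 T, ∀ t ∈ Ico 0 T, s ≤ t →
      dist (toLog (Ξ s)) (toLog (Ξ t)) ≤ C * dist s t := fun s hs t ht hst => by
    have hsub : Icc s t ⊆ Ico 0 T := ordConnected_Ico.out hs ht
    rw [dist_comm, dist_eq_norm, dist_comm, Real.dist_eq, abs_of_nonneg (sub_nonneg.2 hst)]
    exact norm_image_sub_le_of_norm_deriv_right_le_segment (hcont'.mono hsub)
      (fun u hu => hder' u (hsub (Ico_subset_Icc_self hu)))
      (fun u hu => hbound u (hsub (Ico_subset_Icc_self hu))) t ⟨hst, le_rfl⟩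
  have hlip : LipschitzOnWith C.toNNReal (fun t => toLog (Ξ t)) (Ico 0 T) :=
    LipschitzOnWith.of_dist_le_mul fun s hs t ht => by
      rw [Real.coe_toNNReal C hC0]
      rcases le_total s t with hst | hst
      · exact hle s hs t ht hst
      · rw [dist_comm, dist_comm s t]
        exact hle t ht s hs hst
  -- The Lipschitz extension supplies a limit at `T`. As `log ρ` has a finite limit, `ρ` stays
  -- positive there.
  obtain ⟨g, hg, hgeq⟩ := hlip.extend_finite_dimension
  refine ⟨ofLog (g T), ofLog_mem _, ?_⟩
  refine (((continuous_ofLog.comp hg.continuous).tendsto T).mono_left nhdsWithin_le_nhds).congr' ?_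
  filter_upwards [Ico_mem_nhdsLT hT] with t ht
  rw [Function.comp, ← hgeq ht, ofLog_toLog (hmem ht)]

/-- A continuous feedback that does not increase `V` makes the closed loop forward complete. -/
theorem isForwardComplete_of_nonpos (hc₁ : ContinuousOn c₁ closedStateSpace)
    (hc₂ : ContinuousOn c₂ closedStateSpace)
    (hneg : ∀ Ξ ∈ stateSpace, ν₁ Ξ * c₁ Ξ + ν₂ Ξ * c₂ Ξ ≤ 0) :
    IsForwardComplete (fun Ξ => Ξ.1 * c₁ Ξ) c₂ where
  exists_trajectory _ h := exists_isClosedLoopOn_Ici hc₁ hc₂ hneg h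
  extends_trajectory T hT Ξ h := by
    have hk := continuousOn_rhs subset_rfl (hc₁.mono stateSpace_subset)
      (hc₂.mono stateSpace_subset)
    obtain ⟨Ξ₁, hΞ₁, hlim⟩ := exists_tendsto_of_isClosedLoopOn hc₁ hc₂ hneg hT h
    obtain ⟨Y, hY0, hY⟩ := exists_isClosedLoopOn_Ici hc₁ hc₂ hneg hΞ₁
    obtain ⟨hmem, hcont, hder⟩ := (isClosedLoopOn_iff (isTimeInterval_Ico hT) hk).1 h
    obtain ⟨hYmem, hYcont, hYder⟩ := (isClosedLoopOn_iff isTimeInterval_Ici hk).1 hY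
    -- At the junction only the right derivative matters, and it comes from `Y` alone; continuity is
    -- the sole matching condition.
    let Z : ℝ → State := fun t => if t < T then Ξ t else Y (t - T)
    have hZlt : ∀ t, t < T → Z t = Ξ t := fun t ht => if_pos ht
    have hZge : ∀ t, T ≤ t → Z t = Y (t - T) := fun t ht => if_neg (not_lt.2 ht)
    refine ⟨Z, fun t ht => hZlt t ht.2, (isClosedLoopOn_iff isTimeInterval_Ici hk).2 ⟨?_, ?_, ?_⟩⟩
    · intro t ht
      rcases lt_or_ge t T with htT | htT
      · rw [hZlt t htT]
        exact hmem ⟨ht, htT⟩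
      · rw [hZge t htT]
        exact hYmem (sub_nonneg.2 htT)
    · have hZr : ContinuousOn Z (Ici T) := by
        refine ContinuousOn.congr (hYcont.comp (continuousOn_id.sub continuousOn_const)
          fun t ht => mem_Ici.2 (sub_nonneg.2 (mem_Ici.1 ht))) fun t ht => hZge t ht
      intro t ht
      rcases lt_trichotomy t T with htT | rfl | htT
      · refine ((hcont t ⟨ht, htT⟩).congr_of_eventuallyEq ?_
          (hZlt t htT)).mono_of_mem_nhdsWithin ?_
        · filter_upwards [self_mem_nhdsWithin] with s hs using hZlt s hs.2
        · exact inter_mem self_mem_nhdsWithin (mem_nhdsWithin_of_mem_nhds (Iio_mem_nhds htT))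
      · refine (continuousAt_iff_continuous_left'_right'.2 ⟨?_, ?_⟩).continuousWithinAt
        · have hZt : Z t = Ξ₁ := by rw [hZge t le_rfl, sub_self, hY0]
          rw [ContinuousWithinAt, hZt]
          refine hlim.congr' ?_
          filter_upwards [self_mem_nhdsWithin] with s hs using (hZlt s hs).symm
        · exact (hZr t (mem_Ici.2 le_rfl)).mono Ioi_subset_Ici_self
      · exact (hZr.continuousAt (Ici_mem_nhds htT)).continuousWithinAt
    · intro t ht
      rcases lt_or_ge t T with htT | htT
      · rw [hZlt t htT]
        refine (hder t ⟨ht, htT⟩).congr_of_eventuallyEq ?_ (hZlt t htT)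
        filter_upwards [mem_nhdsWithin_of_mem_nhds (Iio_mem_nhds htT)] with s hs using hZlt s hs
      · rw [hZge t htT]
        have h1 := (hYder (t - T) (sub_nonneg.2 htT)).scomp t
          (h := fun s => s - T) (h' := 1) (s := Ici t) ((hasDerivWithinAt_id t _).sub_const T)
          fun s hs => sub_le_sub_right (mem_Ici.1 hs) T
        rw [one_smul] at h1
        exact h1.congr (fun s hs => hZge s (htT.trans hs)) (hZge t htT)

end Completeness

/-! ### Inverse optimality and global asymptotic stability -/

section Optimality

/-- The gain `-ε g(ε|ν|) sgn ν` of a feedback with profile `g`. -/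
noncomputable def gain (g : ℝ → ℝ) (ε ν : State → ℝ) (Ξ : State) : ℝ :=
  -(ε Ξ * (g (ε Ξ * |ν Ξ|) * Real.sign (ν Ξ)))

lemma continuousOn_gain {g : ℝ → ℝ} (hg : ContinuousOn g (Ici 0)) (h0 : g 0 = 0) {ε ν : State → ℝ}
    {s : Set State} (hε : ContinuousOn ε s) (hν : ContinuousOn ν s) (hpos : ∀ Ξ ∈ s, 0 < ε Ξ) :
    ContinuousOn (gain g ε ν) s :=
  (hε.mul (continuousOn_odd_profile hg h0 hε hν hpos)).neg

lemma mul_gain (g : ℝ → ℝ) (ε ν : State → ℝ) (Ξ : State) :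
    ν Ξ * gain g ε ν Ξ = -(ε Ξ * |ν Ξ| * g (ε Ξ * |ν Ξ|)) := by
  rw [gain, ← mul_sign_eq_abs (ν Ξ)]
  ring

lemma abs_gain {g : ℝ → ℝ} (hg : ∀ r, 0 ≤ r → 0 ≤ g r) (h0 : g 0 = 0) {ε : State → ℝ}
    (ν : State → ℝ) {Ξ : State} (hε : 0 < ε Ξ) :
    |gain g ε ν Ξ| = ε Ξ * g (ε Ξ * |ν Ξ|) := by
  have hr : 0 ≤ g (ε Ξ * |ν Ξ|) := hg _ (by positivity)
  rw [gain, abs_neg, abs_mul, abs_mul, abs_of_pos hε, abs_of_nonneg hr]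
  rcases lt_trichotomy (ν Ξ) 0 with h | h | h
  · simp [Real.sign_of_neg h]
  · simp [h, h0]
  · simp [Real.sign_of_pos h]

namespace IsControlPenalty

variable {a : EReal} {η : ℝ → ℝ}

lemma mul_gain_derInv (h : IsControlPenalty a η) {ε : State → ℝ} (ν : State → ℝ) {Ξ : State}
    (hε : 0 < ε Ξ) : ν Ξ * gain (derInv a η) ε ν Ξ =
      -(legendre a η (ε Ξ * |ν Ξ|) + η (derInv a η (ε Ξ * |ν Ξ|))) := by
  rw [mul_gain, h.legendre_add_eq (by positivity)]

/-- The division by `ε|ν|` in the companion feedback is designed for this cancellation: each input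
contributes exactly `-ℓη(ε|ν|)` to `dV/dt`. -/
lemma mul_gain_legendre_div (a : EReal) (η : ℝ → ℝ) (ε ν : State → ℝ) (Ξ : State) :
    ν Ξ * gain (fun r => legendre a η r / r) ε ν Ξ = -legendre a η (ε Ξ * |ν Ξ|) := by
  rw [mul_gain]
  by_cases h0 : ε Ξ * |ν Ξ| = 0
  · rw [h0, legendre_zero, zero_mul]
  · rw [mul_div_cancel₀ _ h0]

/-- Young's inequality for `|n u| = (e|n|)(|u|/e)`; outside the domain of `η` the right side is
infinite. -/
lemma ofReal_abs_mul_le (h : IsControlPenalty a η) {e n u : ℝ} (he : 0 < e) :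
    ENNReal.ofReal |n * u| ≤
      ENNReal.ofReal (legendre a η (e * |n|)) + controlPenalty a η (|u| / e) := by
  rw [controlPenalty]
  split_ifs with hd
  · rw [← ENNReal.ofReal_add (h.legendre_nonneg (by positivity)) (h.kInf.nonneg hd)]
    refine ENNReal.ofReal_le_ofReal ((le_of_eq ?_).trans (h.mul_le_legendre_add (by positivity) hd))
    rw [abs_mul]
    field_simp
  · simp

lemma ofReal_legendre_add_controlPenalty (h : IsControlPenalty a η) {ε : State → ℝ}
    (ν : State → ℝ) {Ξ : State} (hε : 0 < ε Ξ) :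
    ENNReal.ofReal (legendre a η (ε Ξ * |ν Ξ|)) +
      controlPenalty a η (|gain (derInv a η) ε ν Ξ| / ε Ξ) =
        ENNReal.ofReal (-(ν Ξ * gain (derInv a η) ε ν Ξ)) := by
  have hr : 0 ≤ ε Ξ * |ν Ξ| := by positivity
  rw [h.mul_gain_derInv ν hε, neg_neg, abs_gain (fun r => h.derInv_nonneg) h.derInv_zero ν hε,
    mul_div_cancel_left₀ _ hε.ne', controlPenalty, if_pos (h.derInv_mem hr),
    ENNReal.ofReal_add (h.legendre_nonneg hr) (h.kInf.nonneg (h.derInv_mem hr))]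

end IsControlPenalty

/-- Two control penalties, with continuous positive weights. -/
structure IsPenaltyData (a₁ a₂ : EReal) (η₁ η₂ : ℝ → ℝ) (ε₁ ε₂ : State → ℝ) : Prop where
  pen₁ : IsControlPenalty a₁ η₁
  pen₂ : IsControlPenalty a₂ η₂
  cont₁ : ContinuousOn ε₁ closedStateSpace
  cont₂ : ContinuousOn ε₂ closedStateSpace
  pos₁ : ∀ Ξ ∈ closedStateSpace, 0 < ε₁ Ξ
  pos₂ : ∀ Ξ ∈ closedStateSpace, 0 < ε₂ Ξ

lemma vStar_eq (a : EReal) (η : ℝ → ℝ) (ε : State → ℝ) :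
    vStar a η ε = fun Ξ => Ξ.1 * gain (derInv a η) ε ν₁ Ξ := by
  funext Ξ
  rw [vStar, gain]
  ring

lemma ωStar_eq (a : EReal) (η : ℝ → ℝ) (ε : State → ℝ) :
    ωStar a η ε = gain (derInv a η) ε ν₂ := by
  funext Ξ
  rw [ωStar, gain]
  ring

lemma vLaw_eq (a : EReal) (η : ℝ → ℝ) (ε : State → ℝ) :
    (fun Ξ : State => vLaw a η Ξ.1 (ε Ξ) (ν₁ Ξ)) =
      fun Ξ => Ξ.1 * gain (fun r => legendre a η r / r) ε ν₁ Ξ := by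
  funext Ξ
  rw [vLaw, gain]
  ring

lemma ωLaw_eq (a : EReal) (η : ℝ → ℝ) (ε : State → ℝ) :
    (fun Ξ : State => ωLaw a η (ε Ξ) (ν₂ Ξ)) = gain (fun r => legendre a η r / r) ε ν₂ := by
  funext Ξ
  rw [ωLaw, gain]
  ring

namespace IsPenaltyData

variable {a₁ a₂ : EReal} {η₁ η₂ : ℝ → ℝ} {ε₁ ε₂ : State → ℝ}

lemma statePenalty_nonneg (h : IsPenaltyData a₁ a₂ η₁ η₂ ε₁ ε₂) {Ξ : State}
    (hΞ : Ξ ∈ closedStateSpace) : 0 ≤ statePenalty a₁ a₂ η₁ η₂ ε₁ ε₂ Ξ :=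
  add_nonneg (h.pen₁.legendre_nonneg (mul_nonneg (h.pos₁ Ξ hΞ).le (abs_nonneg _)))
    (h.pen₂.legendre_nonneg (mul_nonneg (h.pos₂ Ξ hΞ).le (abs_nonneg _)))

lemma statePenalty_eq_zero_iff (h : IsPenaltyData a₁ a₂ η₁ η₂ ε₁ ε₂) {Ξ : State}
    (hΞ : Ξ ∈ closedStateSpace) : statePenalty a₁ a₂ η₁ η₂ ε₁ ε₂ Ξ = 0 ↔ Ξ = 0 := by
  have h1 : 0 ≤ ε₁ Ξ * |ν₁ Ξ| := mul_nonneg (h.pos₁ Ξ hΞ).le (abs_nonneg _)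
  have h2 : 0 ≤ ε₂ Ξ * |ν₂ Ξ| := mul_nonneg (h.pos₂ Ξ hΞ).le (abs_nonneg _)
  rw [statePenalty, add_eq_zero_iff_of_nonneg (h.pen₁.legendre_nonneg h1)
    (h.pen₂.legendre_nonneg h2), h.pen₁.legendre_eq_zero_iff h1, h.pen₂.legendre_eq_zero_iff h2,
    mul_eq_zero_iff_left (h.pos₁ Ξ hΞ).ne', mul_eq_zero_iff_left (h.pos₂ Ξ hΞ).ne', abs_eq_zero,
    abs_eq_zero]
  refine ⟨fun hν => eq_zero_of_ν_eq_zero hν.1 hν.2, ?_⟩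
  rintro rfl
  exact ⟨ν₁_zero, ν₂_zero⟩

lemma continuousOn_statePenalty (h : IsPenaltyData a₁ a₂ η₁ η₂ ε₁ ε₂) :
    ContinuousOn (statePenalty a₁ a₂ η₁ η₂ ε₁ ε₂) closedStateSpace :=
  (h.pen₁.continuousOn_legendre.comp (h.cont₁.mul continuous_ν₁.abs.continuousOn)
    fun Ξ hΞ => mul_nonneg (h.pos₁ Ξ hΞ).le (abs_nonneg _)).add
  (h.pen₂.continuousOn_legendre.comp (h.cont₂.mul continuous_ν₂.abs.continuousOn)
    fun Ξ hΞ => mul_nonneg (h.pos₂ Ξ hΞ).le (abs_nonneg _))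

/-- The shell `c ≤ V ≤ M` is compact and excludes the origin, the only zero of the penalty. -/
lemma exists_le_statePenalty (h : IsPenaltyData a₁ a₂ η₁ η₂ ε₁ ε₂) {c : ℝ} (hc : 0 < c) (M : ℝ) :
    ∃ m, 0 < m ∧ ∀ Ξ ∈ closedStateSpace, c ≤ V Ξ → V Ξ ≤ M →
      m ≤ statePenalty a₁ a₂ η₁ η₂ ε₁ ε₂ Ξ := by
  obtain ⟨m, hm, hm'⟩ := (isCompact_V_mem (isClosed_Icc (a := c) (b := M))
    fun _ hr => hr.2).exists_forall_le' (h.continuousOn_statePenalty.mono inter_subset_left)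
    (a := 0) fun Ξ hΞ => by
      refine lt_of_le_of_ne (h.statePenalty_nonneg hΞ.1) fun h0 => ?_
      have h1 : Ξ = 0 := (h.statePenalty_eq_zero_iff hΞ.1).1 h0.symm
      have h2 : c ≤ V Ξ := hΞ.2.1
      rw [h1, V_zero] at h2
      exact absurd hc (not_lt.2 h2)
  exact ⟨m, hm, fun Ξ h1 h2 h3 => hm' Ξ ⟨h1, h2, h3⟩⟩

/-- The cost of a trajectory is at least the initial value of `V`. -/
lemma ofReal_V_le_cost (h : IsPenaltyData a₁ a₂ η₁ η₂ ε₁ ε₂) {v ω : ℝ → ℝ} {Ξ : ℝ → State}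
    (hΞ : IsTrajectoryOn (Ici 0) v ω Ξ) :
    ENNReal.ofReal (V (Ξ 0)) ≤ cost a₁ a₂ η₁ η₂ ε₁ ε₂ v ω Ξ := by
  by_contra! hlt
  have hfin : cost a₁ a₂ η₁ η₂ ε₁ ε₂ v ω Ξ ≠ ⊤ := (hlt.trans ENNReal.ofReal_lt_top).ne
  set j := (cost a₁ a₂ η₁ η₂ ε₁ ε₂ v ω Ξ).toReal with hj
  have hjV : j < V (Ξ 0) := by
    rw [← ENNReal.ofReal_toReal hfin] at hlt
    exact (ENNReal.ofReal_lt_ofReal_iff_of_nonneg ENNReal.toReal_nonneg).1 hlt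
  set f : ℝ → ℝ := fun s => ν₁ (Ξ s) * (v s / (Ξ s).1) + ν₂ (Ξ s) * ω s with hf
  have hpt : ∀ s ∈ Ici (0 : ℝ), ENNReal.ofReal |f s| ≤
      ENNReal.ofReal (statePenalty a₁ a₂ η₁ η₂ ε₁ ε₂ (Ξ s))
        + controlPenalty a₁ η₁ (|v s| / (ε₁ (Ξ s) * (Ξ s).1))
        + controlPenalty a₂ η₂ (|ω s| / ε₂ (Ξ s)) := fun s hs => by
    have hm : Ξ s ∈ stateSpace := hΞ.mem s hs
    have hm0 : 0 < (Ξ s).1 := hm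
    have hp₁ := h.pos₁ _ (stateSpace_subset hm)
    have hp₂ := h.pos₂ _ (stateSpace_subset hm)
    have e₁ : |v s| / (ε₁ (Ξ s) * (Ξ s).1) = |v s / (Ξ s).1| / ε₁ (Ξ s) := by
      rw [abs_div, abs_of_pos hm0, div_div, mul_comm]
    rw [e₁, statePenalty, ENNReal.ofReal_add (h.pen₁.legendre_nonneg (by positivity))
      (h.pen₂.legendre_nonneg (by positivity))]
    calc ENNReal.ofReal |f s|
        ≤ ENNReal.ofReal |ν₁ (Ξ s) * (v s / (Ξ s).1)| + ENNReal.ofReal |ν₂ (Ξ s) * ω s| :=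
          (ENNReal.ofReal_le_ofReal (abs_add_le _ _)).trans ENNReal.ofReal_add_le
      _ ≤ _ := add_le_add (h.pen₁.ofReal_abs_mul_le hp₁) (h.pen₂.ofReal_abs_mul_le hp₂)
      _ = _ := by abel
  -- The total variation of `V` along the trajectory is bounded by the cost.
  have hVj : ∀ t ∈ Ici (0 : ℝ), |V (Ξ t) - V (Ξ 0)| ≤ j := fun t ht => by
    obtain ⟨hi, he⟩ := hΞ.integral_eq_V_sub isTimeInterval_Ici ht
    have hi' : IntegrableOn f (Ioc 0 t) := (intervalIntegrable_iff_integrableOn_Ioc_of_le ht).1 hi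
    rw [← he, intervalIntegral.integral_of_le ht]
    refine (abs_integral_le_integral_abs).trans ?_
    rw [hj, ← ENNReal.ofReal_le_iff_le_toReal hfin,
      ofReal_integral_eq_lintegral_ofReal hi'.abs (Eventually.of_forall fun s => abs_nonneg _)]
    exact (lintegral_mono_set (Ioc_subset_Icc_self.trans Icc_subset_Ici_self)).trans
      (setLIntegral_mono' measurableSet_Ici hpt)
  -- `V` remains at least `V (Ξ 0) - j > 0`, so the running cost is at least `m > 0` forever.
  obtain ⟨m, hm, hml⟩ := h.exists_le_statePenalty (sub_pos.2 hjV) (V (Ξ 0) + j)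
  refine hfin (eq_top_iff.2 ?_)
  have htop : ∫⁻ _ in Ici (0 : ℝ), ENNReal.ofReal m = ⊤ := by
    rw [setLIntegral_const, Real.volume_Ici, ENNReal.mul_top (ENNReal.ofReal_pos.2 hm).ne']
  rw [← htop]
  refine setLIntegral_mono' measurableSet_Ici fun s hs => ?_
  obtain ⟨hl, hu⟩ := abs_le.1 (hVj s hs)
  rw [add_assoc]
  exact (ENNReal.ofReal_le_ofReal (hml _ (stateSpace_subset (hΞ.mem s hs)) (by linarith)
    (by linarith))).trans le_self_add

/-- Equality in Young's inequality turns the running cost into `-dV/dt`, whose integral telescopes;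
`V ≥ 0` discards the terminal value, and monotone convergence over `(0, n]` gives the whole
half-line. -/
lemma cost_le_ofReal_V (h : IsPenaltyData a₁ a₂ η₁ η₂ ε₁ ε₂) {Ξ : ℝ → State}
    (hΞ : IsClosedLoopOn (Ici 0) (vStar a₁ η₁ ε₁) (ωStar a₂ η₂ ε₂) Ξ) :
    cost a₁ a₂ η₁ η₂ ε₁ ε₂ (fun t => vStar a₁ η₁ ε₁ (Ξ t)) (fun t => ωStar a₂ η₂ ε₂ (Ξ t)) Ξ
      ≤ ENNReal.ofReal (V (Ξ 0)) := by
  rw [vStar_eq, ωStar_eq] at *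
  set g₁ := gain (derInv a₁ η₁) ε₁ ν₁
  set g₂ := gain (derInv a₂ η₂) ε₂ ν₂
  set f : ℝ → ℝ := fun s => ν₁ (Ξ s) * ((Ξ s).1 * g₁ (Ξ s) / (Ξ s).1) + ν₂ (Ξ s) * g₂ (Ξ s)
  have hpt : ∀ s ∈ Ici (0 : ℝ), 0 ≤ -f s ∧
      ENNReal.ofReal (statePenalty a₁ a₂ η₁ η₂ ε₁ ε₂ (Ξ s))
        + controlPenalty a₁ η₁ (|(Ξ s).1 * g₁ (Ξ s)| / (ε₁ (Ξ s) * (Ξ s).1))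
        + controlPenalty a₂ η₂ (|g₂ (Ξ s)| / ε₂ (Ξ s)) = ENNReal.ofReal (-f s) := fun s hs => by
    have hm : Ξ s ∈ stateSpace := hΞ.mem s hs
    have hm0 : 0 < (Ξ s).1 := hm
    have hp₁ := h.pos₁ _ (stateSpace_subset hm)
    have hp₂ := h.pos₂ _ (stateSpace_subset hm)
    have e₁ : |(Ξ s).1 * g₁ (Ξ s)| / (ε₁ (Ξ s) * (Ξ s).1) = |g₁ (Ξ s)| / ε₁ (Ξ s) := by
      rw [abs_mul, abs_of_pos hm0]
      field_simp
    have hr₁ : 0 ≤ ε₁ (Ξ s) * |ν₁ (Ξ s)| := by positivity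
    have hr₂ : 0 ≤ ε₂ (Ξ s) * |ν₂ (Ξ s)| := by positivity
    have ef : -f s = -(ν₁ (Ξ s) * g₁ (Ξ s)) + -(ν₂ (Ξ s) * g₂ (Ξ s)) := by
      simp only [f, mul_div_cancel_left₀ _ hm0.ne']
      ring
    have n₁ : 0 ≤ -(ν₁ (Ξ s) * g₁ (Ξ s)) := by
      rw [mul_gain, neg_neg]
      exact mul_nonneg hr₁ (h.pen₁.derInv_nonneg hr₁)
    have n₂ : 0 ≤ -(ν₂ (Ξ s) * g₂ (Ξ s)) := by
      rw [mul_gain, neg_neg]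
      exact mul_nonneg hr₂ (h.pen₂.derInv_nonneg hr₂)
    rw [ef]
    refine ⟨add_nonneg n₁ n₂, ?_⟩
    rw [e₁, statePenalty, ENNReal.ofReal_add (h.pen₁.legendre_nonneg hr₁)
      (h.pen₂.legendre_nonneg hr₂), ENNReal.ofReal_add n₁ n₂,
      ← h.pen₁.ofReal_legendre_add_controlPenalty ν₁ hp₁,
      ← h.pen₂.ofReal_legendre_add_controlPenalty ν₂ hp₂]
    abel
  have hIci : (⋃ n : ℕ, Ioc (0 : ℝ) n) = Ioi 0 := by
    ext x
    simp only [mem_iUnion, mem_Ioc, mem_Ioi]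
    exact ⟨fun ⟨n, hn⟩ => hn.1, fun hx => ⟨_, hx, Nat.le_ceil x⟩⟩
  have hdir : Directed (· ⊆ ·) fun n : ℕ => Ioc (0 : ℝ) n :=
    (monotone_nat_of_le_succ fun n => Ioc_subset_Ioc_right (by push_cast; linarith)).directed_le
  rw [cost, setLIntegral_congr_fun measurableSet_Ici fun s hs => (hpt s hs).2,
    setLIntegral_congr Ioi_ae_eq_Ici.symm, ← hIci, setLIntegral_iUnion_of_directed _ hdir]
  refine iSup_le fun n => ?_
  have hn : (n : ℝ) ∈ Ici (0 : ℝ) := mem_Ici.2 n.cast_nonneg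
  obtain ⟨hi, he⟩ := IsTrajectoryOn.integral_eq_V_sub hΞ isTimeInterval_Ici hn
  have hi' : IntegrableOn f (Ioc 0 n) := (intervalIntegrable_iff_integrableOn_Ioc_of_le hn).1 hi
  have hnn : 0 ≤ᵐ[volume.restrict (Ioc 0 (n : ℝ))] fun s => -f s :=
    (ae_restrict_iff' measurableSet_Ioc).2 (Eventually.of_forall fun s hs =>
      (hpt s (mem_Ici.2 hs.1.le)).1)
  rw [← ofReal_integral_eq_lintegral_ofReal (f := fun s => -f s) hi'.neg hnn, integral_neg,
    ← intervalIntegral.integral_of_le hn, he]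
  exact ENNReal.ofReal_le_ofReal (by linarith [V_nonneg (Ξ n)])

theorem isMinimizing (h : IsPenaltyData a₁ a₂ η₁ η₂ ε₁ ε₂) :
    IsMinimizing a₁ a₂ η₁ η₂ ε₁ ε₂ (vStar a₁ η₁ ε₁) (ωStar a₂ η₂ ε₂) where
  forwardComplete := by
    rw [vStar_eq, ωStar_eq]
    refine isForwardComplete_of_nonpos
      (continuousOn_gain h.pen₁.continuousOn_derInv h.pen₁.derInv_zero h.cont₁
        continuous_ν₁.continuousOn h.pos₁)
      (continuousOn_gain h.pen₂.continuousOn_derInv h.pen₂.derInv_zero h.cont₂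
        continuous_ν₂.continuousOn h.pos₂) fun Ξ hΞ => ?_
    have hr₁ := mul_nonneg (h.pos₁ Ξ (stateSpace_subset hΞ)).le (abs_nonneg (ν₁ Ξ))
    have hr₂ := mul_nonneg (h.pos₂ Ξ (stateSpace_subset hΞ)).le (abs_nonneg (ν₂ Ξ))
    rw [mul_gain, mul_gain]
    linarith [mul_nonneg hr₁ (h.pen₁.derInv_nonneg hr₁),
      mul_nonneg hr₂ (h.pen₂.derInv_nonneg hr₂)]
  cost_lt_top Ξ hΞ := (h.cost_le_ofReal_V hΞ).trans_lt ENNReal.ofReal_lt_top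
  cost_le Ξ hΞ v ω Ξ' hΞ' h0 := by
    refine (h.cost_le_ofReal_V hΞ).trans ?_
    rw [← h0]
    exact h.ofReal_V_le_cost hΞ'

theorem isGAS (h : IsPenaltyData a₁ a₂ η₁ η₂ ε₁ ε₂) :
    IsGAS (fun Ξ => vLaw a₁ η₁ Ξ.1 (ε₁ Ξ) (ν₁ Ξ)) (fun Ξ => ωLaw a₂ η₂ (ε₂ Ξ) (ν₂ Ξ)) := by
  rw [vLaw_eq, ωLaw_eq]
  set g₁ := gain (fun r => legendre a₁ η₁ r / r) ε₁ ν₁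
  set g₂ := gain (fun r => legendre a₂ η₂ r / r) ε₂ ν₂
  have hVdot : ∀ Ξ, ν₁ Ξ * g₁ Ξ + ν₂ Ξ * g₂ Ξ = -statePenalty a₁ a₂ η₁ η₂ ε₁ ε₂ Ξ := fun Ξ => by
    rw [IsControlPenalty.mul_gain_legendre_div, IsControlPenalty.mul_gain_legendre_div,
      statePenalty]
    ring
  have hneg : ∀ Ξ ∈ stateSpace, ν₁ Ξ * g₁ Ξ + ν₂ Ξ * g₂ Ξ ≤ 0 := fun Ξ hΞ => by
    rw [hVdot]
    exact neg_nonpos.2 (h.statePenalty_nonneg (stateSpace_subset hΞ))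
  have hsqrt : ∀ e > (0 : ℝ), ∀ Ξ, V Ξ < (e / 2) ^ 2 → ‖Ξ‖ < e := fun e he Ξ hV => by
    have := (Real.sqrt_lt' (by positivity)).2 hV
    linarith [norm_le_two_mul_sqrt_V Ξ]
  refine ⟨isForwardComplete_of_nonpos
    (continuousOn_gain h.pen₁.continuousOn_legendre_div (by simp) h.cont₁
      continuous_ν₁.continuousOn h.pos₁)
    (continuousOn_gain h.pen₂.continuousOn_legendre_div (by simp) h.cont₂
      continuous_ν₂.continuousOn h.pos₂) hneg, fun e he => ?_, fun Ξ hΞ => ?_⟩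
  · obtain ⟨d, hd, hdV⟩ := Metric.continuousAt_iff.1 (continuous_V.continuousAt (x := (0 : State)))
      ((e / 2) ^ 2) (by positivity)
    refine ⟨d, hd, fun Ξ hΞ h0 t ht => hsqrt e he _ ?_⟩
    refine (V_le_of_isClosedLoopOn isTimeInterval_Ici hneg hΞ (mem_Ici.2 le_rfl) ht ht).trans_lt ?_
    have := hdV (x := Ξ 0) (by simpa using h0)
    rw [V_zero, Real.dist_eq, sub_zero] at this
    exact (le_abs_self _).trans_lt this
  · have hsmall : ∀ c > (0 : ℝ), ∃ t ≥ (0 : ℝ), V (Ξ t) < c := fun c hc => by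
      by_contra! hge
      obtain ⟨m, hm, hml⟩ := h.exists_le_statePenalty hc (V (Ξ 0))
      -- If `V` decreased at rate at least `m` up to this time, it would be at most `0`,
      -- contradicting `V ≥ c`.
      have hT : (0 : ℝ) ≤ V (Ξ 0) / m := div_nonneg (V_nonneg _) hm.le
      obtain ⟨hi, he⟩ := IsTrajectoryOn.integral_eq_V_sub hΞ isTimeInterval_Ici (mem_Ici.2 hT)
      have hint := intervalIntegral.integral_mono_on hT hi
        (intervalIntegrable_const (c := -m)) fun s hs => by
          have hs0 : s ∈ Ici (0 : ℝ) := hs.1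
          have hsm := hΞ.mem s hs0
          rw [mul_div_cancel_left₀ _ (ne_of_gt hsm), hVdot]
          exact neg_le_neg (hml _ (stateSpace_subset hsm) (hge s hs0)
            (V_le_of_isClosedLoopOn isTimeInterval_Ici hneg hΞ (mem_Ici.2 le_rfl) hs0 hs0))
      rw [he, intervalIntegral.integral_const, smul_eq_mul, sub_zero, mul_neg,
        div_mul_cancel₀ _ hm.ne'] at hint
      linarith [hge _ hT]
    rw [Metric.tendsto_atTop]
    intro e he
    obtain ⟨T, hT, hVT⟩ := hsmall ((e / 2) ^ 2) (by positivity)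
    refine ⟨T, fun t ht => ?_⟩
    rw [dist_zero_right]
    exact hsqrt e he _ ((V_le_of_isClosedLoopOn isTimeInterval_Ici hneg hΞ hT
      (mem_Ici.2 (hT.trans ht)) ht).trans_lt hVT)

end IsPenaltyData

/-- The feedback profile `-ε ℓη(ε|ν|) / (ε|ν|) sgn ν` is continuous in `ν`. -/
lemma IsControlPenalty.continuous_ωLaw {a : EReal} {η : ℝ → ℝ} (h : IsControlPenalty a η) {e : ℝ}
    (he : 0 < e) : Continuous (ωLaw a η e) := by
  have h1 := continuousOn_odd_profile h.continuousOn_legendre_div (by simp)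
    (continuousOn_const (c := e) (s := univ)) continuousOn_id fun _ _ => he
  refine (continuous_const.mul (continuousOn_univ.1 h1) : Continuous fun n : ℝ =>
    -e * (legendre a η (e * |id n|) / (e * |id n|) * Real.sign (id n))).congr fun n => ?_
  rw [ωLaw, mul_assoc]
  rfl

end Optimality

end Unicycle

theorem theorem1
    (a₁ a₂ : EReal) (ha₁ : 0 < a₁) (ha₂ : 0 < a₂)
    (η₁ η₂ : ℝ → ℝ) (hη₁ : IsControlPenalty a₁ η₁) (hη₂ : IsControlPenalty a₂ η₂)
    (ε₁ ε₂ : State → ℝ)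
    (hε₁ : ContinuousOn ε₁ closedStateSpace) (hε₂ : ContinuousOn ε₂ closedStateSpace)
    (hε₁_pos : ∀ Ξ ∈ closedStateSpace, 0 < ε₁ Ξ)
    (hε₂_pos : ∀ Ξ ∈ closedStateSpace, 0 < ε₂ Ξ) :
    -- the state penalty is positive definite
    (∀ Ξ ∈ closedStateSpace, 0 ≤ statePenalty a₁ a₂ η₁ η₂ ε₁ ε₂ Ξ ∧
      (statePenalty a₁ a₂ η₁ η₂ ε₁ ε₂ Ξ = 0 ↔ Ξ = 0)) ∧
    -- the feedback (v*, ω*) minimizes the cost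
    IsMinimizing a₁ a₂ η₁ η₂ ε₁ ε₂ (vStar a₁ η₁ ε₁) (ωStar a₂ η₂ ε₂) ∧
    -- the companion feedback is continuous in (ν₁, ν₂)
    (∀ Ξ ∈ stateSpace, Continuous fun ν : ℝ × ℝ =>
      (vLaw a₁ η₁ Ξ.1 (ε₁ Ξ) ν.1, ωLaw a₂ η₂ (ε₂ Ξ) ν.2)) ∧
    -- and it renders the origin globally asymptotically stable
    IsGAS (fun Ξ => vLaw a₁ η₁ Ξ.1 (ε₁ Ξ) (ν₁ Ξ)) (fun Ξ => ωLaw a₂ η₂ (ε₂ Ξ) (ν₂ Ξ)) := by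
  have h : IsPenaltyData a₁ a₂ η₁ η₂ ε₁ ε₂ := ⟨hη₁, hη₂, hε₁, hε₂, hε₁_pos, hε₂_pos⟩
  refine ⟨fun Ξ hΞ => ⟨h.statePenalty_nonneg hΞ, h.statePenalty_eq_zero_iff hΞ⟩, h.isMinimizing,
    fun Ξ hΞ => ?_, h.isGAS⟩
  have h1 : ∀ n, vLaw a₁ η₁ Ξ.1 (ε₁ Ξ) n = Ξ.1 * ωLaw a₁ η₁ (ε₁ Ξ) n := fun n => by
    rw [vLaw, ωLaw]
    ring
  have hc₁ := hη₁.continuous_ωLaw (hε₁_pos Ξ (stateSpace_subset hΞ))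
  have hc₂ := hη₂.continuous_ωLaw (hε₂_pos Ξ (stateSpace_subset hΞ))
  simp only [h1]
  exact (continuous_const.mul (hc₁.comp continuous_fst)).prodMk (hc₂.comp continuous_snd)
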